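/- \textbf{Setting.} Let $k$ be a finite field, $H$ a finite abelian group with $\operatorname{char} k\nmid |H|$, and $J$ a finite-dimensional nilpotent associative $k$-algebra with commuting linear left and right actions of $H$, i.e. $(hx)h'=h(xh')$, such that $h(xy)=(hx)y$, $(xy)h=x(yh)$ and $x(hy)=(xh)y$ for $h,h'\in H$, $x,y\in J$. Then the set $G=H+J$ of formal sums $h+x$ is a finite group under $(h_1+x_1)(h_2+x_2)=h_1h_2+(h_1x_2+x_1h_2+x_1x_2)$, called a finite group of triangular type. A subgroup of triangular type is $G'=H'+J'$, where $H'\le H$ is a subgroup and $J'\subseteq J$ is a $k$-subalgebra with $H'J'\subseteq J'$ and $J'H'\subseteq J'$; it is itself a finite group of triangular type. \textbf{Supercharacters.} Fix a nontrivial character $t\mapsto\varepsilon^t$ of the additive group of $k$ with values in $\mathbb C^*$. For an idempotent $e$ of the group algebra $kH$ put $H(e)=\{h\in H: he=e\}$, $H_e=He$, $J_e=eJe$, $N_e=e+J_e$, and let $J_e^*$ be identified with the space of all linear forms $\lambda\in J^*$ with $\lambda(exe)=\lambda(x)$ for all $x\in J$. The triples $(t,a,b)$ with $t\in H_e$, $a,b\in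 N_e$ act on $J_e$ by $x\mapsto taxb^{-1}t^{-1}$, and contragrediently on $J_e^*$; an orbit $\omega\subseteq J_e^*$ of this action is called regular (with respect to $H_e$) if $\omega\cap J_f^*=\varnothing$ for every idempotent $f\neq e$ of $e(kH)$. Let $\alpha=(e,\theta,\omega)$ consist of an idempotent $e$ of $kH$, a linear character $\theta:H(e)\to\mathbb C^*$ and a regular orbit $\omega\subseteq J_e^*$. Choose $\lambda\in\omega$ and put $J_{\lambda,\mathrm{right}}=\{x\in J:\lambda(xJ)=0\}$ and $G_\alpha=H(e)+J_{\lambda,\mathrm{right}}$, a subgroup of $G$ with linear character $\xi_{\theta,\lambda}(h+x)=\theta(h)\varepsilon^{\lambda(x)}$. The supercharacters of $G$ are the induced characters $\chi_\alpha=\operatorname{Ind}(\xi_{\theta,\lambda},G_\alpha,G)$. The supercharacters of $G'$ are defined in the same way from $H'$, $J'$ and the same $\varepsilon$. \textbf{Theorem.} Let $G=H+J$ be a finite group of triangular type and $G'=H'+J'$ a subgroup of triangular type. Then the restriction to $G'$ of every supercharacter $\chi_\alpha$ of $G$ is a sum of supercharacters of $G'$ with nonnegative integer coefficients. -/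

import Mathlib

/-- The data of a finite group of triangular type `G = H + J` over `k` (finiteness of `H`, of `k`
and of the dimension of `J` is assumed separately): an abelian group `H` acting linearly from the
left, `left h x = hx`, and from the right, `right h x = xh`, on a nilpotent associative `k`-algebra
`J`, compatibly with the multiplication of `J`, where `char k` does not divide `|H|`.
As `H` is commutative, a right action of `H` is the same as a representation of `H`. -/
structure TriangularData (k H J : Type*) [Field k] [CommGroup H] [NonUnitalRing J] [Module k J] where
  left : Representation k H J
  right : Representation k H J
  /-- `h(xh') = (hx)h'` -/
  left_right : ∀ (h h' : H) (x : J), left h (right h' x) = right h' (left h x)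
  /-- `h(xy) = (hx)y` -/
  left_mul : ∀ (h : H) (x y : J), left h (x * y) = left h x * y
  /-- `(xy)h = x(yh)` -/
  right_mul : ∀ (h : H) (x y : J), right h (x * y) = x * right h y
  /-- `x(hy) = (xh)y` -/
  mul_left : ∀ (h : H) (x y : J), x * left h y = right h x * y
  /-- For some `n`, all products of `n + 1` elements of `J` vanish. -/
  nilpotent : ∃ n : ℕ, ∀ (x : J) (l : List J), l.length = n → l.foldl (fun a b => a * b) x = 0
  char_not_dvd : ¬ ringChar k ∣ Nat.card H

namespace TriangularData

variable {k H J : Type*} [Field k] [CommGroup H] [NonUnitalRing J] [Module k J]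

/-- The set `G = H + J` of formal sums `h + x`. -/
@[ext] structure Grp (T : TriangularData k H J) where
  fst : H
  snd : J

section GroupStructure

variable (T : TriangularData k H J)

/-- `(h₁ + x₁)(h₂ + x₂) = h₁h₂ + (h₁x₂ + x₁h₂ + x₁x₂)` -/
instance : Mul T.Grp where
  mul g₁ g₂ := ⟨g₁.fst * g₂.fst, T.left g₁.fst g₂.snd + T.right g₂.fst g₁.snd + g₁.snd * g₂.snd⟩

instance : One T.Grp where
  one := ⟨1, 0⟩

@[simp] theorem mul_fst (g₁ g₂ : T.Grp) : (g₁ * g₂).fst = g₁.fst * g₂.fst := rfl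

@[simp] theorem mul_snd (g₁ g₂ : T.Grp) : (g₁ * g₂).snd =
    T.left g₁.fst g₂.snd + T.right g₂.fst g₁.snd + g₁.snd * g₂.snd := rfl

@[simp] theorem one_fst : (1 : T.Grp).fst = 1 := rfl

@[simp] theorem one_snd : (1 : T.Grp).snd = 0 := rfl

theorem right_right (h₁ h₂ : H) (x : J) : T.right h₁ (T.right h₂ x) = T.right (h₂ * h₁) x := by
  rw [mul_comm, map_mul]; rfl

theorem left_left (h₁ h₂ : H) (x : J) : T.left h₁ (T.left h₂ x) = T.left (h₁ * h₂) x := by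
  rw [map_mul]; rfl

theorem grp_mul_assoc (a b c : T.Grp) : a * b * c = a * (b * c) := by
  ext
  · simp [mul_assoc]
  · simp only [mul_fst, mul_snd, map_add, add_mul, mul_add, T.left_mul, T.right_mul, T.mul_left,
      T.left_right, T.right_right, ← T.left_left, mul_assoc]
    abel

theorem grp_one_mul (a : T.Grp) : 1 * a = a := by
  ext <;> simp

/-- Since `J` is nilpotent, `z + zu = w` is solvable in `z` for all `u`, `w`. -/
theorem exists_add_mul_eq (T : TriangularData k H J) [IsScalarTower k J J] (u w : J) : ∃ z : J, z + z * u = w := by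
  obtain ⟨n, hn⟩ := T.nilpotent
  let f : Module.End k J :=
    { toFun := fun z => z * u
      map_add' := fun a b => add_mul a b u
      map_smul' := fun c a => smul_mul_assoc c a u }
  have hf : ∀ (m : ℕ) (x : J),
      (List.replicate m u).foldl (fun a b => a * b) x = (f ^ m) x := by
    intro m
    induction m with
    | zero => intro x; simp
    | succ m ih =>
      intro x
      rw [List.replicate_succ, List.foldl_cons, ih, pow_succ]
      rfl
  have hnil : IsNilpotent f := by
    refine ⟨n, LinearMap.ext fun x => ?_⟩
    rw [← hf n x, hn x _ (by simp)]
    rfl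
  have hu := hnil.isUnit_one_add
  obtain ⟨z, hz⟩ := ((Module.End.isUnit_iff _).1 hu).2 w
  exact ⟨z, hz⟩

theorem grp_exists_inv [IsScalarTower k J J] (a : T.Grp) : ∃ b : T.Grp, b * a = 1 := by
  obtain ⟨z, hz⟩ := T.exists_add_mul_eq (T.left a.fst⁻¹ a.snd) (-T.left a.fst⁻¹ a.snd)
  refine ⟨⟨a.fst⁻¹, T.right a.fst⁻¹ z⟩, ?_⟩
  ext
  · simp
  · simp only [mul_snd, one_snd, T.right_right, ← T.mul_left]
    rw [add_assoc]
    simp [hz]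

noncomputable instance [IsScalarTower k J J] : Group T.Grp :=
  { (inferInstance : Mul T.Grp), (inferInstance : One T.Grp) with
    inv := fun a => (T.grp_exists_inv a).choose
    mul_assoc := T.grp_mul_assoc
    one_mul := T.grp_one_mul
    mul_one := fun a => by ext <;> simp
    inv_mul_cancel := fun a => (T.grp_exists_inv a).choose_spec }

end GroupStructure

section Idempotents

variable (T : TriangularData k H J)

/-- The left action `x ↦ ax` on `J` of an element `a` of the group algebra `kH`. -/
noncomputable def lact (a : MonoidAlgebra k H) : Module.End k J := T.left.asAlgebraHom a

/-- The right action `x ↦ xa` on `J` of an element `a` of the group algebra `kH`. -/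
noncomputable def ract (a : MonoidAlgebra k H) : Module.End k J := T.right.asAlgebraHom a

/-- The Peirce component `J_e = eJe = {x | exe = x}` for an idempotent `e` of `kH`. -/
def corner (e : MonoidAlgebra k H) : Set J := {x | T.lact e (T.ract e x) = x}

/-- `J_e^*` as a subspace of `J^*`: the forms `lam` with `lam (exe) = lam x` for all `x`, that is,
those that vanish on the other three components of the Peirce decomposition
`J = eJe ⊕ eJ(1-e) ⊕ (1-e)Je ⊕ (1-e)J(1-e)`. -/
def dualCorner (e : MonoidAlgebra k H) : Set (Module.Dual k J) :=
  {lam | ∀ x, lam (T.lact e (T.ract e x)) = lam x}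

/-- The orbit in `J_e^*` of `lam ∈ J_e^*` under the group of triples `(t, a, b)`, `t ∈ H_e = He`,
`a, b ∈ N_e = e + J_e`, acting on `J_e` by `x ↦ t a x b⁻¹ t⁻¹` and on `J_e^*` contragrediently.
Here `a = e + u` and `b⁻¹ = e + v` with `u`, `v` in `J_e`; note that `lam` does not change when
`e + u`, `e + v` are replaced by `1 + u`, `1 + v`. -/
def dualOrbit (e : MonoidAlgebra k H) (lam : Module.Dual k J) : Set (Module.Dual k J) :=
  {mu | ∃ t : H, ∃ u ∈ T.corner e, ∃ v ∈ T.corner e,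
    ∀ x, mu x = lam (T.left t (T.right t⁻¹ (x + u * x + x * v + u * x * v)))}

/-- The orbit of `lam ∈ J_e^*` is regular with respect to `H_e`: it does not meet `J_f^*` for any
idempotent `f ≠ e` of `kH_e = e(kH)`. -/
def IsRegular (e : MonoidAlgebra k H) (lam : Module.Dual k J) : Prop :=
  ∀ f : MonoidAlgebra k H, IsIdempotentElem f → f * e = f → f ≠ e →
    Disjoint (T.dualOrbit e lam) (T.dualCorner f)

end Idempotents

/-- `H(e) = {h ∈ H | he = e}` -/
def idemStab (e : MonoidAlgebra k H) : Subgroup H where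
  carrier := {h | MonoidAlgebra.of k H h * e = e}
  mul_mem' {a b} ha hb := by
    simp only [Set.mem_ofPred_eq] at *
    rw [map_mul, mul_assoc, hb, ha]
  one_mem' := by rw [Set.mem_ofPred_eq, map_one, one_mul]
  inv_mem' {a} ha := by
    simp only [Set.mem_ofPred_eq] at *
    conv_lhs => rw [← ha]
    rw [← mul_assoc, ← map_mul, inv_mul_cancel, map_one, one_mul]

section Supercharacters

variable (T : TriangularData k H J)

theorem dual_left {e : MonoidAlgebra k H} {lam : Module.Dual k J} (hlam : lam ∈ T.dualCorner e)
    {h : H} (hh : h ∈ idemStab e) (x : J) : lam (T.left h x) = lam x := by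
  have hh' : MonoidAlgebra.of k H h * e = e := hh
  have h1 : T.lact e (T.left h (T.ract e x)) = T.lact e (T.ract e x) := by
    have : T.left h = T.lact (MonoidAlgebra.of k H h) := by simp [lact]
    rw [this, lact, lact, ← Module.End.mul_apply, ← map_mul, mul_comm, hh']
  have h2 : ∀ (a : MonoidAlgebra k H) (y : J), T.ract a (T.left h y) = T.left h (T.ract a y) := by
    intro a y
    induction a using MonoidAlgebra.induction_on with
    | of g => simp [ract, T.left_right]
    | add a b ha hb => simp only [ract, map_add, LinearMap.add_apply] at *; rw [ha, hb]
    | smul r a ha => simp only [ract, map_smul, LinearMap.smul_apply] at *; rw [ha]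
  rw [← hlam (T.left h x), h2, h1, hlam]

theorem dual_right {e : MonoidAlgebra k H} {lam : Module.Dual k J} (hlam : lam ∈ T.dualCorner e)
    {h : H} (hh : h ∈ idemStab e) (x : J) : lam (T.right h x) = lam x := by
  have hh' : MonoidAlgebra.of k H h * e = e := hh
  have h1 : T.ract e (T.right h x) = T.ract e x := by
    have : T.right h = T.ract (MonoidAlgebra.of k H h) := by simp [ract]
    rw [this, ract, ract, ← Module.End.mul_apply, ← map_mul, mul_comm, hh']
  rw [← hlam (T.right h x), h1, hlam]

variable [IsScalarTower k J J]

/-- The subgroup `G_α = H(e) + J_{lam,right}`, where `J_{lam,right} = {x | lam (xJ) = 0}`. -/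
def stabGroup (e : MonoidAlgebra k H) (lam : Module.Dual k J) (hlam : lam ∈ T.dualCorner e) :
    Subgroup T.Grp where
  carrier := {g | g.fst ∈ idemStab e ∧ ∀ y, lam (g.snd * y) = 0}
  mul_mem' {a b} ha hb := by
    refine ⟨mul_mem ha.1 hb.1, fun y => ?_⟩
    rw [mul_snd, add_mul, add_mul, map_add, map_add, ← T.left_mul, T.dual_left hlam ha.1,
      ← T.mul_left, mul_assoc, ha.2, ha.2, hb.2]
    simp
  one_mem' := ⟨one_mem _, fun y => by simp⟩
  inv_mem' {a} ha := by
    have h1 : a * a⁻¹ = 1 := mul_inv_cancel a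
    have hf : (a⁻¹).fst = (a.fst)⁻¹ := by
      have := congrArg Grp.fst h1
      rw [mul_fst, one_fst] at this
      exact eq_inv_of_mul_eq_one_right this
    have hs := congrArg Grp.snd h1
    rw [mul_snd, one_snd] at hs
    refine ⟨by rw [hf]; exact inv_mem ha.1, fun y => ?_⟩
    have h2 := congrArg (fun z => lam (z * y)) hs
    simp only [add_mul, map_add, zero_mul, map_zero] at h2
    rw [← T.left_mul, T.dual_left hlam ha.1, ← T.mul_left, mul_assoc, ha.2, ha.2] at h2
    simpa using h2

/-- The linear character `ξ_{θ,lam}(h + x) = θ(h) ε(lam x)` of `G_α`. -/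
noncomputable def linChar (ε : AddChar k ℂ) (e : MonoidAlgebra k H) (θ : idemStab e →* ℂˣ)
    (lam : Module.Dual k J) (hlam : lam ∈ T.dualCorner e) : T.stabGroup e lam hlam →* ℂ where
  toFun g := (θ ⟨g.1.fst, g.2.1⟩ : ℂ) * ε (lam g.1.snd)
  map_one' := by
    have : (⟨(1 : T.Grp).fst, (T.stabGroup e lam hlam).one_mem.1⟩ : idemStab e) = 1 := rfl
    have h2 : ((1 : T.stabGroup e lam hlam) : T.Grp).snd = 0 := rfl
    change (θ ⟨(1 : T.Grp).fst, (T.stabGroup e lam hlam).one_mem.1⟩ : ℂ) * _ = 1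
    rw [this, h2, map_one, map_zero, AddChar.map_zero_eq_one, Units.val_one, one_mul]
  map_mul' a b := by
    have h1 : (⟨(a * b).1.fst, (a * b).2.1⟩ : idemStab e) =
        ⟨a.1.fst, a.2.1⟩ * ⟨b.1.fst, b.2.1⟩ := rfl
    have h2 : lam (a * b).1.snd = lam a.1.snd + lam b.1.snd := by
      rw [Subgroup.coe_mul, mul_snd, map_add, map_add, T.dual_left hlam a.2.1,
        T.dual_right hlam b.2.1, a.2.2]
      abel
    rw [h1, h2, map_mul, AddChar.map_add_eq_mul, Units.val_mul]
    ring

end Supercharacters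

/-- The character of a finite group `G` induced from a linear character `ξ` of a subgroup `K`:
`g ↦ |K|⁻¹ ∑_{s ∈ G, s⁻¹gs ∈ K} ξ(s⁻¹gs)`. -/
noncomputable def inducedChar {G : Type*} [Group G] (K : Subgroup G) (ξ : K →* ℂ) : G → ℂ :=
  open Classical in
  fun g => (Nat.card K : ℂ)⁻¹ *
    ∑ᶠ s : G, if hs : s⁻¹ * g * s ∈ K then ξ ⟨s⁻¹ * g * s, hs⟩ else 0

/-- The set of supercharacters `χ_α = Ind(ξ_{θ,lam}, G_α, G)` of `G = H + J`, where `α = (e, θ, ω)`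
runs over the triples of an idempotent `e` of `kH`, a linear character `θ` of `H(e)` and a regular
orbit `ω` in `J_e^*`, represented by an element `lam` of it. -/
def supercharacters (T : TriangularData k H J) [IsScalarTower k J J] (ε : AddChar k ℂ) :
    Set (T.Grp → ℂ) :=
  {χ | ∃ (e : MonoidAlgebra k H) (θ : idemStab e →* ℂˣ) (lam : Module.Dual k J)
      (hlam : lam ∈ T.dualCorner e), IsIdempotentElem e ∧ T.IsRegular e lam ∧
      χ = inducedChar (T.stabGroup e lam hlam) (T.linChar ε e θ lam hlam)}

/-- A subgroup of triangular type `G' = H' + J'` of `G = H + J`: a subgroup `H'` of `H` and a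
subalgebra `J'` of `J` that is invariant under the left and right actions of `H'`. -/
structure SubData (T : TriangularData k H J) where
  subH : Subgroup H
  subJ : NonUnitalSubalgebra k J
  left_mem : ∀ h ∈ subH, ∀ x ∈ subJ, T.left h x ∈ subJ
  right_mem : ∀ h ∈ subH, ∀ x ∈ subJ, T.right h x ∈ subJ

namespace SubData

variable {T : TriangularData k H J} (S : T.SubData)

/-- `G' = H' + J'` is itself of triangular type, with the restricted actions. -/
def toData : TriangularData k S.subH S.subJ where
  left :=
    { toFun := fun h => (T.left h).restrict (p := S.subJ.toSubmodule) (q := S.subJ.toSubmodule)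
        (fun x hx => S.left_mem h h.2 x hx)
      map_one' := by ext x; simp
      map_mul' := fun a b => by ext x; simp }
  right :=
    { toFun := fun h => (T.right h).restrict (p := S.subJ.toSubmodule) (q := S.subJ.toSubmodule)
        (fun x hx => S.right_mem h h.2 x hx)
      map_one' := by ext x; simp
      map_mul' := fun a b => by ext x; simp }
  left_right h h' x := Subtype.ext (T.left_right h h' x)
  left_mul h x y := Subtype.ext (T.left_mul h x y)
  right_mul h x y := Subtype.ext (T.right_mul h x y)
  mul_left h x y := Subtype.ext (T.mul_left h x y)
  nilpotent := by
    obtain ⟨n, hn⟩ := T.nilpotent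
    refine ⟨n, fun x l hl => Subtype.ext ?_⟩
    have key : ∀ (l : List S.subJ) (x : S.subJ),
        ((l.foldl (fun a b => a * b) x : S.subJ) : J) =
          (l.map (fun a => (a : J))).foldl (fun a b => a * b) (x : J) := by
      intro l
      induction l with
      | nil => intro x; rfl
      | cons a l ih => intro x; rw [List.foldl_cons, ih]; rfl
    rw [key, hn _ _ (by simpa using hl)]
    rfl
  char_not_dvd hd := T.char_not_dvd (hd.trans S.subH.card_subgroup_dvd_card)

/-- The inclusion `h + x ↦ h + x` of `G' = H' + J'` into `G = H + J`. -/
def incl [IsScalarTower k J J] : S.toData.Grp →* T.Grp where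
  toFun g := ⟨g.fst, g.snd⟩
  map_one' := rfl
  map_mul' _ _ := rfl

end SubData

end TriangularData

/-! Regularity of the orbit obstructs a direct Mackey argument, so it is dropped first. For any
subgroup A of H and any form lam invariant under A from both sides, h + x ↦ θ(h) ε(lam x) is a
linear character of A + J_{lam,right}; call the induced character `annInd` a generalized
supercharacter. Every supercharacter is one, and conversely each is a nonnegative integer
combination of supercharacters (`annInd_mem_span`): induction to a larger A splits into the
extensions of θ, and a nonregular orbit meets some smaller J_f^*. It therefore suffices to restrict
generalized supercharacters.

Restriction goes to H' + J and then down the chain J ⊇ J' + JJ ⊇ ..., which reaches J' by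
nilpotency; in each step the smaller algebra contains all products. Mackey's formula
(`restrict_conjSum_mem`) leaves one term per double coset. For H' + J the double cosets have
representatives in H. When JJ ⊆ J' there are representatives 1 + v such that v commutes with the
group B of H-components of the intersection, which is then B + (J' ∩ J_{mu,right}) for a conjugate
form mu.

This is not yet B + R, where R is the right annihilator in J' of mu restricted to J'. Fourier
expansion on R replaces mu by the forms w ↦ mu(w + wz). The group B permutes the perturbations y ↦
mu(yz) of R, and each B-orbit contributes the combination of supercharacters given by one form with
its stabilizer in the place of B (`conjSum_annChar_grpMap_mem_span`). -/

set_option linter.unusedSectionVars false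

/-! ### Sums over conjugates, orbits and Mackey's formula -/

section Generic

/-- `g ↦ ∑_{s ∈ G} F(s⁻¹gs)` -/
noncomputable def conjSum {G : Type*} [Group G] [Fintype G] (F : G → ℂ) : G → ℂ :=
  fun g => ∑ s : G, F (s⁻¹ * g * s)

theorem conjSum_conj {G : Type*} [Group G] [Fintype G] (F : G → ℂ) (a : G) :
    conjSum (fun g => F (a⁻¹ * g * a)) = conjSum F := by
  funext g
  refine Fintype.sum_equiv (Equiv.mulRight a) _ _ fun s => ?_
  simp [mul_assoc]

theorem conjSum_const_mul {G : Type*} [Group G] [Fintype G] (c : ℂ) (F : G → ℂ) :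
    conjSum (fun g => c * F g) = c • conjSum F := by
  funext g
  simp [conjSum, Finset.mul_sum]

theorem conjSum_sum {G ι : Type*} [Group G] [Fintype G] (s : Finset ι) (F : ι → G → ℂ) :
    conjSum (fun g => ∑ i ∈ s, F i g) = ∑ i ∈ s, conjSum (F i) := by
  funext g
  simp only [conjSum, Finset.sum_apply]
  exact Finset.sum_comm

-- By orbit-stabilizer the weight is the reciprocal of the orbit length, so each orbit contributes
-- the common value of `Q` exactly once. This is the source of integral coefficients.
open Classical in
theorem orbit_sum_mem {B X E : Type*} [Group B] [Finite B] [Fintype X] [MulAction B X]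
    [AddCommGroup E] [Module ℂ E] (C : Submodule ℕ E) (Q : X → E)
    (hQ : ∀ (b : B) (x : X), Q (b • x) = Q x) (hC : ∀ x, Q x ∈ C) :
    ∑ x : X, ((Nat.card (MulAction.stabilizer B x) : ℂ) / Nat.card B) • Q x ∈ C := by
  rw [← Finset.sum_fiberwise (s := Finset.univ)
    (g := fun x : X => (Quotient.mk'' x : MulAction.orbitRel.Quotient B X))]
  refine Submodule.sum_mem _ fun q _ => ?_
  obtain ⟨x, rfl⟩ := Quotient.mk''_surjective q
  have hmem : ∀ y : X, (Quotient.mk'' y : MulAction.orbitRel.Quotient B X) = Quotient.mk'' x ↔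
      y ∈ MulAction.orbit B x := fun y => by
    rw [Quotient.eq'', MulAction.orbitRel_apply]
  have hcard : ∀ y : X, Nat.card (MulAction.stabilizer B y) * Nat.card (MulAction.orbit B y) =
      Nat.card B := fun y => by
    rw [mul_comm, ← Nat.card_prod, Nat.card_congr (MulAction.orbitProdStabilizerEquivGroup B y)]
  have hB : (Nat.card B : ℂ) ≠ 0 := Nat.cast_ne_zero.2 Nat.card_pos.ne'
  have key : ∀ y ∈ Finset.univ.filter
      (fun y : X => (Quotient.mk'' y : MulAction.orbitRel.Quotient B X) = Quotient.mk'' x),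
      ((Nat.card (MulAction.stabilizer B y) : ℂ) / Nat.card B) • Q y =
        (Nat.card (MulAction.orbit B x) : ℂ)⁻¹ • Q x := by
    intro y hy
    rw [Finset.mem_filter, hmem] at hy
    have ho : MulAction.orbit B y = MulAction.orbit B x := MulAction.orbit_eq_iff.2 hy.2
    obtain ⟨b, rfl⟩ := hy.2
    have h1 : (Nat.card (MulAction.stabilizer B (b • x)) : ℂ) * Nat.card (MulAction.orbit B x) =
        Nat.card B := by
      rw [← ho]; exact_mod_cast hcard (b • x)
    have h2 : (Nat.card (MulAction.orbit B x) : ℂ) ≠ 0 := fun h => hB (by rw [← h1, h, mul_zero])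
    change _ • Q (b • x) = _
    rw [hQ, ← h1]
    congr 1
    have h3 : (Nat.card (MulAction.stabilizer B (b • x)) : ℂ) ≠ 0 :=
      fun h => hB (by rw [← h1, h, zero_mul])
    field_simp
  rw [Finset.sum_congr rfl key, Finset.sum_const]
  have hc : (Finset.univ.filter (fun y : X =>
      (Quotient.mk'' y : MulAction.orbitRel.Quotient B X) = Quotient.mk'' x)).card =
      Nat.card (MulAction.orbit B x) := by
    rw [Nat.card_eq_fintype_card, Fintype.card_subtype]
    congr 1
    ext y
    simp [hmem]
  have h2 : (Nat.card (MulAction.orbit B x) : ℂ) ≠ 0 := fun h => by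
    have := hcard x
    rw [Nat.cast_eq_zero.1 h, mul_zero] at this
    exact hB (by rw [← this, Nat.cast_zero])
  rw [hc, ← Nat.cast_smul_eq_nsmul ℂ, smul_smul, mul_inv_cancel₀ h2, one_smul]
  exact hC x

/-- The sum over one orbit is induced from the stabilizer of any of its points. The element `a` in
the hypothesis allows a convenient point to be chosen. -/
theorem equivariant_sum_mem {G X : Type*} [Group G] [Fintype G] [Fintype X] [MulAction G X]
    (C : Submodule ℕ (G → ℂ)) (c : X → G → ℂ)
    (hc : ∀ (a : G) (x : X) (g : G), c (a • x) (a * g * a⁻¹) = c x g)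
    (h : ∀ x, ∃ a : G,
      (Nat.card (MulAction.stabilizer G (a • x)) : ℂ)⁻¹ • conjSum (c (a • x)) ∈ C) :
    (fun g => ∑ x, c x g) ∈ C := by
  have hG : (Nat.card G : ℂ) ≠ 0 := by simp
  have hQ : ∀ (a : G) (x : X),
      (Nat.card (MulAction.stabilizer G (a • x)) : ℂ)⁻¹ • conjSum (c (a • x)) =
      (Nat.card (MulAction.stabilizer G x) : ℂ)⁻¹ • conjSum (c x) := by
    intro a x
    have h1 : Nat.card (MulAction.stabilizer G (a • x)) =
        Nat.card (MulAction.stabilizer G x) := by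
      rw [MulAction.stabilizer_smul_eq_stabilizer_map_conj]
      exact Nat.card_congr (Subgroup.equivMapOfInjective _ _
        (MulAut.conj a).injective).symm.toEquiv
    have h2 : c (a • x) = fun g => c x (a⁻¹ * g * a) := by
      funext g
      rw [← hc a x]
      congr 1
      group
    rw [h1, h2, conjSum_conj]
  have := orbit_sum_mem C
    (fun x => (Nat.card (MulAction.stabilizer G x) : ℂ)⁻¹ • conjSum (c x)) hQ
    (fun x => by obtain ⟨a, ha⟩ := h x; rwa [hQ] at ha)
  convert this using 1
  funext g
  have hst : ∀ x : X, (Nat.card (MulAction.stabilizer G x) : ℂ) ≠ 0 :=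
    fun x => Nat.cast_ne_zero.2 Nat.card_pos.ne'
  simp only [smul_smul, Finset.sum_apply, Pi.smul_apply, smul_eq_mul]
  have e1 : ∀ x : X, (Nat.card (MulAction.stabilizer G x) : ℂ) / Nat.card G *
      (Nat.card (MulAction.stabilizer G x) : ℂ)⁻¹ = (Nat.card G : ℂ)⁻¹ := fun x => by
    have := hst x
    field_simp
  simp only [e1, conjSum]
  rw [← Finset.mul_sum, Finset.sum_comm]
  have e2 : ∀ s : G, ∑ x, c x (s⁻¹ * g * s) = ∑ x, c x g := fun s => by
    refine Fintype.sum_equiv (MulAction.toPerm s) _ _ fun x => ?_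
    rw [MulAction.toPerm_apply, ← hc s x]
    congr 1
    group
  simp only [e2, Finset.sum_const, Finset.card_univ, nsmul_eq_mul, ← Nat.card_eq_fintype_card]
  rw [inv_mul_cancel_left₀ hG]

/-- Mackey's formula: `G'` acts on `G ⧸ K` through `φ`, its orbits are the double cosets, and the
stabilizer of sK is the preimage of sKs⁻¹. The elements `a` and `k` allow s to be changed within its
double coset. -/
theorem restrict_conjSum_mem {G G' : Type*} [Group G] [Fintype G] [Group G'] [Fintype G']
    (φ : G' →* G) (K : Subgroup G) (F : G → ℂ) (hF : ∀ k ∈ K, ∀ g, F (k⁻¹ * g * k) = F g)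
    (C : Submodule ℕ (G' → ℂ))
    (h : ∀ s : G, ∃ a : G', ∃ k ∈ K,
      (Nat.card {g : G' // (φ a * s * k)⁻¹ * φ g * (φ a * s * k) ∈ K} : ℂ)⁻¹ •
        conjSum (fun g => F ((φ a * s * k)⁻¹ * φ g * (φ a * s * k))) ∈ C) :
    (fun g => ((Nat.card K : ℂ)⁻¹ • conjSum F) (φ g)) ∈ C := by
  classical
  let _ : MulAction G' (G ⧸ K) := MulAction.compHom _ φ
  have hsm : ∀ (a : G') (s : G), a • (s : G ⧸ K) = ((φ a * s : G) : G ⧸ K) := fun a s => rfl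
  let c : G ⧸ K → G' → ℂ := fun x g => Quotient.liftOn' x (fun s => F (s⁻¹ * φ g * s)) (by
    intro s s' hss
    rw [QuotientGroup.leftRel_apply] at hss
    rw [← hF _ hss]
    congr 1
    group)
  have hcm : ∀ (s : G) (g : G'), c (s : G ⧸ K) g = F (s⁻¹ * φ g * s) := fun s g => rfl
  have key := equivariant_sum_mem C c (by
    intro a x g
    induction x using QuotientGroup.induction_on with | _ s => ?_
    rw [hsm, hcm, hcm]
    congr 1
    simp only [map_mul, map_inv]
    group) (by
    intro x
    induction x using QuotientGroup.induction_on with | _ s => ?_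
    obtain ⟨a, k, hk, hC⟩ := h s
    refine ⟨a, ?_⟩
    have e : a • (s : G ⧸ K) = ((φ a * s * k : G) : G ⧸ K) := by
      rw [hsm]
      exact QuotientGroup.eq.2 (by rwa [inv_mul_cancel_left])
    rw [e]
    have e2 : Nat.card (MulAction.stabilizer G' ((φ a * s * k : G) : G ⧸ K)) =
        Nat.card {g : G' // (φ a * s * k)⁻¹ * φ g * (φ a * s * k) ∈ K} :=
      Nat.card_congr (Equiv.subtypeEquivRight fun g => by
        rw [MulAction.mem_stabilizer_iff, hsm, eq_comm, QuotientGroup.eq, mul_assoc _ (φ g)])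
    rw [e2]
    exact hC)
  convert key using 1
  funext g
  have hK : (Nat.card K : ℂ) ≠ 0 := by simp
  simp only [Pi.smul_apply, smul_eq_mul, conjSum]
  rw [inv_mul_eq_iff_eq_mul₀ hK, ← Finset.sum_fiberwise (s := Finset.univ)
    (g := fun s : G => (s : G ⧸ K)), Finset.mul_sum]
  refine Finset.sum_congr rfl fun x _ => ?_
  have e1 : ∀ s ∈ Finset.univ.filter (fun s : G => (s : G ⧸ K) = x),
      F (s⁻¹ * φ g * s) = c x g := by
    intro s hs
    rw [← (Finset.mem_filter.1 hs).2, hcm]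
  rw [Finset.sum_congr rfl e1, Finset.sum_const, nsmul_eq_mul]
  congr 2
  obtain ⟨s, rfl⟩ := QuotientGroup.mk_surjective x
  rw [← Fintype.card_subtype, ← Nat.card_eq_fintype_card]
  refine Nat.card_congr ⟨fun y => ⟨s⁻¹ * y.1, QuotientGroup.eq.1 y.2.symm⟩,
    fun k => ⟨s * k.1, (QuotientGroup.eq.2 (by simp)).symm⟩, fun y => ?_, fun k => ?_⟩ <;> simp

theorem sum_addChar_linear {k V : Type*} [Field k] [AddCommGroup V] [Module k V] [Fintype V]
    {ε : AddChar k ℂ} (hε : ε ≠ 1) (f : V →ₗ[k] k) [Decidable (f = 0)] :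
    ∑ v, ε (f v) = if f = 0 then (Nat.card V : ℂ) else 0 := by
  split_ifs with h
  · simp [h]
  · have h1 : ε.compAddMonoidHom f.toAddMonoidHom ≠ 1 := by
      intro h2
      apply hε
      obtain ⟨v, hv⟩ : ∃ v, f v ≠ 0 := by
        by_contra! h3
        exact h (LinearMap.ext h3)
      ext t
      have := DFunLike.congr_fun h2 ((t / f v) • v)
      simpa [hv] using this
    exact AddChar.sum_eq_zero_of_ne_one h1

end Generic

namespace TriangularData

variable {k H J : Type*} [Field k] [CommGroup H] [NonUnitalRing J] [Module k J]

/-! ### The two-sided action of G on J, and conjugation -/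

section Bimodule

variable [IsScalarTower k J J] [SMulCommClass k J J] (T : TriangularData k H J)

/-- The left action `x ↦ sx` of `G = H + J` on `J`. -/
def lsm (s : T.Grp) : Module.End k J := T.left s.fst + LinearMap.mulLeft k s.snd

/-- The right action `x ↦ xs` of `G = H + J` on `J`. -/
def rsm (s : T.Grp) : Module.End k J := T.right s.fst + LinearMap.mulRight k s.snd

theorem lsm_apply (s : T.Grp) (x : J) : T.lsm s x = T.left s.fst x + s.snd * x := rfl

theorem rsm_apply (s : T.Grp) (x : J) : T.rsm s x = T.right s.fst x + x * s.snd := rfl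

theorem lsm_one (x : J) : T.lsm 1 x = x := by simp [lsm_apply]

theorem rsm_one (x : J) : T.rsm 1 x = x := by simp [rsm_apply]

theorem lsm_lsm (s t : T.Grp) (x : J) : T.lsm s (T.lsm t x) = T.lsm (s * t) x := by
  simp only [lsm_apply, mul_fst, mul_snd, map_add, add_mul, ← T.left_left, T.left_mul,
    T.mul_left, mul_assoc]
  abel

theorem rsm_rsm (s t : T.Grp) (x : J) : T.rsm s (T.rsm t x) = T.rsm (t * s) x := by
  simp only [rsm_apply, mul_fst, mul_snd, map_add, mul_add, ← T.right_right, T.right_mul,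
    T.mul_left, mul_assoc]
  abel

theorem lsm_inv_lsm (s : T.Grp) (x : J) : T.lsm s⁻¹ (T.lsm s x) = x := by
  rw [lsm_lsm, inv_mul_cancel, lsm_one]

theorem lsm_lsm_inv (s : T.Grp) (x : J) : T.lsm s (T.lsm s⁻¹ x) = x := by
  rw [lsm_lsm, mul_inv_cancel, lsm_one]

theorem rsm_inv_rsm (s : T.Grp) (x : J) : T.rsm s⁻¹ (T.rsm s x) = x := by
  rw [rsm_rsm, mul_inv_cancel, rsm_one]

theorem rsm_rsm_inv (s : T.Grp) (x : J) : T.rsm s (T.rsm s⁻¹ x) = x := by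
  rw [rsm_rsm, inv_mul_cancel, rsm_one]

theorem lsm_rsm (s t : T.Grp) (x : J) : T.lsm s (T.rsm t x) = T.rsm t (T.lsm s x) := by
  simp only [lsm_apply, rsm_apply, map_add, T.left_right, T.left_mul,
    T.right_mul, mul_assoc]
  abel

theorem lsm_mul (s : T.Grp) (x y : J) : T.lsm s (x * y) = T.lsm s x * y := by
  simp only [lsm_apply, add_mul, T.left_mul, mul_assoc]

theorem rsm_mul (s : T.Grp) (x y : J) : T.rsm s (x * y) = x * T.rsm s y := by
  simp only [rsm_apply, mul_add, T.right_mul, mul_assoc]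

theorem mul_lsm (s : T.Grp) (x y : J) : x * T.lsm s y = T.rsm s x * y := by
  simp only [lsm_apply, rsm_apply, add_mul, mul_add, T.mul_left, mul_assoc]

theorem mul_snd_left (s g : T.Grp) : (s * g).snd = T.lsm s g.snd + T.right g.fst s.snd := by
  rw [mul_snd, lsm_apply]; abel

theorem mul_snd_right (s g : T.Grp) : (s * g).snd = T.left s.fst g.snd + T.rsm g s.snd := by
  rw [mul_snd, rsm_apply]; abel

theorem inv_fst (s : T.Grp) : (s⁻¹).fst = (s.fst)⁻¹ := by
  have h := congrArg Grp.fst (mul_inv_cancel s)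
  rw [mul_fst, one_fst] at h
  exact eq_inv_of_mul_eq_one_right h

theorem conj_fst (s g : T.Grp) : (s⁻¹ * g * s).fst = g.fst := by
  rw [mul_fst, mul_fst, inv_fst, mul_assoc, mul_comm, mul_assoc, mul_inv_cancel, mul_one]

theorem conj_fst' (s g : T.Grp) : (s * g * s⁻¹).fst = g.fst := by
  simpa using T.conj_fst s⁻¹ g

theorem conj_snd (s g : T.Grp) : (s⁻¹ * g * s).snd =
    T.lsm s⁻¹ (T.left g.fst s.snd - T.right g.fst s.snd) + T.lsm s⁻¹ (T.rsm s g.snd) := by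
  have h : s * (s⁻¹ * g * s) = g * s := by group
  have h1 := congrArg Grp.snd h
  rw [T.mul_snd_left s, T.mul_snd_right g, conj_fst] at h1
  rw [← map_add, ← T.lsm_inv_lsm s (s⁻¹ * g * s).snd, eq_sub_of_add_eq h1]
  congr 1
  abel

/-- Without the commutator term, conjugation is linear in the J-part and so carries linear forms to
linear forms. Double coset representatives are chosen below to meet this condition. -/
theorem conj_snd_of_comm (s g : T.Grp) (h : T.left g.fst s.snd = T.right g.fst s.snd) :
    (s⁻¹ * g * s).snd = T.lsm s⁻¹ (T.rsm s g.snd) := by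
  rw [conj_snd, h, sub_self, map_zero, zero_add]

end Bimodule

/-! ### Generalized supercharacters, without regularity -/

section GeneralizedSupercharacters

variable (T : TriangularData k H J)

/-- `lam` is invariant under `A` acting from the left and from the right. -/
def BiInv (A : Subgroup H) (lam : Module.Dual k J) : Prop :=
  ∀ h ∈ A, ∀ x, lam (T.left h x) = lam x ∧ lam (T.right h x) = lam x

theorem BiInv.mono {T : TriangularData k H J} {A B : Subgroup H} {lam : Module.Dual k J}
    (h : T.BiInv B lam) (hAB : A ≤ B) : T.BiInv A lam := fun a ha => h a (hAB ha)

theorem biInv_idemStab {e : MonoidAlgebra k H} {lam : Module.Dual k J}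
    (hlam : lam ∈ T.dualCorner e) : T.BiInv (idemStab e) lam := fun _ hh x =>
  ⟨T.dual_left hlam hh x, T.dual_right hlam hh x⟩

/-- `J_{lam,right} = {x | lam (xJ) = 0}` -/
def rightAnn [IsScalarTower k J J] (lam : Module.Dual k J) : Submodule k J where
  carrier := {x | ∀ y, lam (x * y) = 0}
  add_mem' ha hb y := by rw [add_mul, map_add, ha, hb, add_zero]
  zero_mem' y := by simp
  smul_mem' c x hx y := by rw [smul_mul_assoc, map_smul, hx, smul_zero]

theorem mem_rightAnn [IsScalarTower k J J] {lam : Module.Dual k J} {x : J} :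
    x ∈ rightAnn lam ↔ ∀ y, lam (x * y) = 0 := Iff.rfl

variable [IsScalarTower k J J]

theorem mul_mem_rightAnn {lam : Module.Dual k J} {x : J} (hx : x ∈ rightAnn lam) (y : J) :
    x * y ∈ rightAnn lam := fun z => by rw [mul_assoc, hx]

theorem right_mem_rightAnn {lam : Module.Dual k J} {x : J} (hx : x ∈ rightAnn lam) (h : H) :
    T.right h x ∈ rightAnn lam := fun z => by rw [← T.mul_left, hx]

theorem left_mem_rightAnn {A : Subgroup H} {lam : Module.Dual k J} (hlam : T.BiInv A lam) {x : J}
    (hx : x ∈ rightAnn lam) {h : H} (hh : h ∈ A) : T.left h x ∈ rightAnn lam := fun z => by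
  rw [← T.left_mul, (hlam h hh _).1, hx]

/-- The subgroup `A + J_{lam,right}`. -/
def annGroup (A : Subgroup H) (lam : Module.Dual k J) (hlam : T.BiInv A lam) :
    Subgroup T.Grp where
  carrier := {g | g.fst ∈ A ∧ g.snd ∈ rightAnn lam}
  mul_mem' {a b} ha hb := ⟨mul_mem ha.1 hb.1, by
    rw [mul_snd]
    exact add_mem (add_mem (T.left_mem_rightAnn hlam hb.2 ha.1) (T.right_mem_rightAnn ha.2 _))
      (mul_mem_rightAnn ha.2 _)⟩
  one_mem' := ⟨one_mem _, zero_mem _⟩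
  inv_mem' {a} ha := by
    have h1 : a * a⁻¹ = 1 := mul_inv_cancel a
    have hf : (a⁻¹).fst = (a.fst)⁻¹ := by
      have := congrArg Grp.fst h1
      rw [mul_fst, one_fst] at this
      exact eq_inv_of_mul_eq_one_right this
    have hs := congrArg Grp.snd h1
    rw [mul_snd, one_snd, add_assoc] at hs
    refine ⟨by rw [hf]; exact inv_mem ha.1, ?_⟩
    have h2 : T.left a.fst (a⁻¹).snd ∈ rightAnn lam := by
      rw [eq_neg_of_add_eq_zero_left hs]
      exact neg_mem (add_mem (T.right_mem_rightAnn ha.2 _) (mul_mem_rightAnn ha.2 _))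
    have h3 := T.left_mem_rightAnn hlam h2 (inv_mem ha.1)
    rwa [left_left, inv_mul_cancel, map_one] at h3

theorem mem_annGroup {A : Subgroup H} {lam : Module.Dual k J} {hlam : T.BiInv A lam}
    {g : T.Grp} : g ∈ T.annGroup A lam hlam ↔ g.fst ∈ A ∧ g.snd ∈ rightAnn lam := Iff.rfl

/-- The underlying set of `H + J` is `H × J`. -/
def grpEquiv : T.Grp ≃ H × J where
  toFun g := (g.fst, g.snd)
  invFun p := ⟨p.1, p.2⟩
  left_inv _ := rfl
  right_inv _ := rfl

instance [Finite H] [Finite J] : Finite T.Grp := Finite.of_equiv _ T.grpEquiv.symm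

noncomputable instance [Finite H] [Finite J] : Fintype T.Grp := Fintype.ofFinite _

theorem card_subtype_grp (P : H → Prop) (Q : J → Prop) :
    Nat.card {g : T.Grp // P g.fst ∧ Q g.snd} = Nat.card {h // P h} * Nat.card {x // Q x} := by
  rw [← Nat.card_prod]
  exact Nat.card_congr ⟨fun g => (⟨g.1.fst, g.2.1⟩, ⟨g.1.snd, g.2.2⟩),
    fun p => ⟨⟨p.1.1, p.2.1⟩, p.1.2, p.2.2⟩, fun _ => rfl, fun _ => rfl⟩

theorem card_annGroup (A : Subgroup H) (lam : Module.Dual k J) (hlam : T.BiInv A lam) :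
    Nat.card (T.annGroup A lam hlam) = Nat.card A * Nat.card (rightAnn lam) :=
  T.card_subtype_grp (· ∈ A) (· ∈ rightAnn lam)

open Classical in
/-- The linear character `h + x ↦ θ(h) ε(lam x)` of `A + J_{lam,right}`, extended by zero. -/
noncomputable def annChar (ε : AddChar k ℂ) (A : Subgroup H) (θ : H →* ℂˣ)
    (lam : Module.Dual k J) : T.Grp → ℂ := fun g =>
  if g.fst ∈ A ∧ g.snd ∈ rightAnn lam then (θ g.fst : ℂ) * ε (lam g.snd) else 0

theorem annChar_mul (ε : AddChar k ℂ) {A : Subgroup H} (θ : H →* ℂˣ) {lam : Module.Dual k J}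
    (hlam : T.BiInv A lam) {a b : T.Grp} (ha : a ∈ T.annGroup A lam hlam)
    (hb : b ∈ T.annGroup A lam hlam) :
    T.annChar ε A θ lam (a * b) = T.annChar ε A θ lam a * T.annChar ε A θ lam b := by
  have h2 : lam (a * b).snd = lam a.snd + lam b.snd := by
    rw [mul_snd, map_add, map_add, (hlam _ ha.1 _).1, (hlam _ hb.1 _).2, ha.2]
    abel
  have hab := mul_mem ha hb
  rw [mem_annGroup] at ha hb hab
  rw [annChar, annChar, annChar, if_pos ha, if_pos hb, if_pos hab, h2, mul_fst,
    map_mul, AddChar.map_add_eq_mul, Units.val_mul]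
  ring

theorem annChar_conj (ε : AddChar k ℂ) {A : Subgroup H} (θ : H →* ℂˣ) {lam : Module.Dual k J}
    (hlam : T.BiInv A lam) {a : T.Grp} (ha : a ∈ T.annGroup A lam hlam) (g : T.Grp) :
    T.annChar ε A θ lam (a⁻¹ * g * a) = T.annChar ε A θ lam g := by
  by_cases hg : g ∈ T.annGroup A lam hlam
  · rw [T.annChar_mul ε θ hlam (mul_mem (inv_mem ha) hg) ha,
      T.annChar_mul ε θ hlam (inv_mem ha) hg, mul_comm, ← mul_assoc,
      ← T.annChar_mul ε θ hlam ha (inv_mem ha), ← T.annChar_mul ε θ hlam (mul_mem ha (inv_mem ha)) hg,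
      mul_inv_cancel, one_mul]
  · have hg' : ¬ (a⁻¹ * g * a ∈ T.annGroup A lam hlam) := fun h => hg (by
      simpa [mul_assoc] using mul_mem (mul_mem ha h) (inv_mem ha))
    rw [mem_annGroup] at hg hg'
    rw [annChar, annChar, if_neg hg, if_neg hg']

/-- The character of `G` induced from the linear character `h + x ↦ θ(h) ε(lam x)` of
`A + J_{lam,right}`. -/
noncomputable def annInd [Finite H] [Finite J] (ε : AddChar k ℂ) (A : Subgroup H) (θ : H →* ℂˣ)
    (lam : Module.Dual k J) : T.Grp → ℂ :=
  ((Nat.card A * Nat.card (rightAnn lam) : ℕ) : ℂ)⁻¹ • conjSum (T.annChar ε A θ lam)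

theorem inducedChar_linChar [Finite H] [Finite J] (ε : AddChar k ℂ) (e : MonoidAlgebra k H)
    (θ : H →* ℂˣ) (lam : Module.Dual k J) (hlam : lam ∈ T.dualCorner e) :
    inducedChar (T.stabGroup e lam hlam) (T.linChar ε e (θ.comp (idemStab e).subtype) lam hlam) =
      T.annInd ε (idemStab e) θ lam := by
  funext g
  have hc : Nat.card (T.stabGroup e lam hlam) =
      Nat.card (idemStab e) * Nat.card (rightAnn lam) :=
    T.card_annGroup (idemStab e) lam (T.biInv_idemStab hlam)
  rw [inducedChar, annInd, hc, finsum_eq_sum_of_fintype, Pi.smul_apply, smul_eq_mul, conjSum]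
  refine congrArg _ (Finset.sum_congr rfl fun s _ => ?_)
  by_cases hs : s⁻¹ * g * s ∈ T.stabGroup e lam hlam
  · rw [dif_pos hs, annChar]
    exact (if_pos hs).symm
  · rw [dif_neg hs, annChar]
    exact (if_neg hs).symm

end GeneralizedSupercharacters

end TriangularData

/-! ### Generalized supercharacters are sums of supercharacters -/

namespace TriangularData

variable {k H J : Type*} [Field k] [CommGroup H] [NonUnitalRing J] [Module k J]

theorem idemStab_mono {e f : MonoidAlgebra k H} (h : f * e = f) : idemStab e ≤ idemStab f := by
  intro a ha
  have ha' : MonoidAlgebra.of k H a * e = e := ha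
  change MonoidAlgebra.of k H a * f = f
  rw [← h, mul_left_comm, ha']

theorem lact_right (T : TriangularData k H J) (e : MonoidAlgebra k H) (h : H) (y : J) :
    T.lact e (T.right h y) = T.right h (T.lact e y) := by
  induction e using MonoidAlgebra.induction_on with
  | of g => simp [lact, T.left_right]
  | add a b ha hb => simp only [lact, map_add, LinearMap.add_apply] at *; rw [ha, hb]
  | smul r a ha => simp only [lact, map_smul, LinearMap.smul_apply] at *; rw [ha]

theorem left_corner (T : TriangularData k H J) {e : MonoidAlgebra k H} {u : J}
    (hu : u ∈ T.corner e) {h : H} (hh : h ∈ idemStab e) : T.left h u = u := by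
  have hh' : MonoidAlgebra.of k H h * e = e := hh
  have hu' : T.lact e (T.ract e u) = u := hu
  have : T.left h = T.lact (MonoidAlgebra.of k H h) := by simp [lact]
  rw [← hu', this, lact, lact, ← Module.End.mul_apply, ← map_mul, hh']

theorem right_corner (T : TriangularData k H J) {e : MonoidAlgebra k H} {u : J}
    (hu : u ∈ T.corner e) {h : H} (hh : h ∈ idemStab e) : T.right h u = u := by
  have hh' : MonoidAlgebra.of k H h * e = e := hh
  have hu' : T.lact e (T.ract e u) = u := hu
  have h1 : T.right h = T.ract (MonoidAlgebra.of k H h) := by simp [ract]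
  have h2 : T.right h (T.ract e u) = T.ract e u := by
    rw [h1, ract, ract, ← Module.End.mul_apply, ← map_mul, hh']
  conv_lhs => rw [← hu', ← lact_right, h2, hu']

section Average

variable [Finite H]

/-- The idempotent `|A|⁻¹ ∑_{a ∈ A} a` of `kH`. -/
noncomputable def avgIdem (k : Type*) [Field k] (A : Subgroup H) [Fintype A] :
    MonoidAlgebra k H :=
  (Nat.card A : k)⁻¹ • ∑ a : A, MonoidAlgebra.of k H a

theorem card_subgroup_ne_zero (T : TriangularData k H J) (A : Subgroup H) :
    (Nat.card A : k) ≠ 0 := fun h =>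
  T.char_not_dvd (((ringChar.spec k _).1 h).trans A.card_subgroup_dvd_card)

theorem le_idemStab_avgIdem (A : Subgroup H) [Fintype A] : A ≤ idemStab (avgIdem k A) := by
  intro a ha
  change MonoidAlgebra.of k H a * avgIdem k A = avgIdem k A
  rw [avgIdem, mul_smul_comm, Finset.mul_sum]
  congr 1
  refine Fintype.sum_equiv (Equiv.mulLeft (⟨a, ha⟩ : A)) _ _ fun b => ?_
  rw [← map_mul]
  rfl

theorem isIdempotentElem_avgIdem (T : TriangularData k H J) (A : Subgroup H) [Fintype A] :
    IsIdempotentElem (avgIdem k A) := by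
  have h : ∀ a : A, MonoidAlgebra.of k H a * avgIdem k A = avgIdem k A :=
    fun a => le_idemStab_avgIdem A a.2
  rw [IsIdempotentElem]
  conv_lhs => enter [1]; rw [avgIdem]
  rw [smul_mul_assoc, Finset.sum_mul, Finset.sum_congr rfl fun a _ => h a, Finset.sum_const,
    Finset.card_univ, ← Nat.card_eq_fintype_card, ← Nat.cast_smul_eq_nsmul k, smul_smul,
    inv_mul_cancel₀ (T.card_subgroup_ne_zero A), one_smul]

theorem mem_dualCorner_avgIdem (T : TriangularData k H J) {A : Subgroup H} [Fintype A]
    {lam : Module.Dual k J} (hlam : T.BiInv A lam) : lam ∈ T.dualCorner (avgIdem k A) := by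
  have key : ∀ (ρ : Representation k H J), (∀ a ∈ A, ∀ x, lam (ρ a x) = lam x) →
      ∀ x, lam (ρ.asAlgebraHom (avgIdem k A) x) = lam x := by
    intro ρ hρ x
    rw [avgIdem, map_smul, map_sum, LinearMap.smul_apply, map_smul, LinearMap.sum_apply, map_sum]
    have : ∀ a : A, lam (ρ.asAlgebraHom (MonoidAlgebra.of k H a) x) = lam x := fun a => by
      rw [Representation.asAlgebraHom_of, hρ a a.2]
    rw [Finset.sum_congr rfl fun a _ => this a, Finset.sum_const,
      Finset.card_univ, ← Nat.card_eq_fintype_card, ← Nat.cast_smul_eq_nsmul k, smul_smul,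
      inv_mul_cancel₀ (T.card_subgroup_ne_zero A), one_smul]
  intro x
  rw [lact, key _ fun a ha x => (hlam a ha x).1, ract, key _ fun a ha x => (hlam a ha x).2]

end Average

variable [IsScalarTower k J J] [Finite H] [Finite J] (T : TriangularData k H J)

theorem rsm_mem_rightAnn_iff [SMulCommClass k J J] {lam : Module.Dual k J} (s : T.Grp) {x : J} :
    T.rsm s x ∈ rightAnn lam ↔ x ∈ rightAnn lam := by
  constructor
  · intro h z
    rw [← T.lsm_lsm_inv s z, T.mul_lsm, h]
  · intro h z
    rw [← T.mul_lsm, h]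

/-- Conjugation by s carries one inducing character to the other. The right factor r matters only
through its H-component, since lam vanishes on products whose left factor is in its right
annihilator. -/
theorem annInd_twist [SMulCommClass k J J] (ε : AddChar k ℂ) (A : Subgroup H) (θ : H →* ℂˣ)
    {lam mu : Module.Dual k J} (s r : T.Grp)
    (hs : ∀ h ∈ A, T.left h s.snd = T.right h s.snd) (hr : r.fst = s.fst⁻¹)
    (hmu : ∀ x, mu x = lam (T.rsm r (T.lsm s x))) :
    T.annInd ε A θ mu = T.annInd ε A θ lam := by
  have h1 : ∀ x, x ∈ rightAnn mu ↔ T.lsm s x ∈ rightAnn lam := fun x => by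
    constructor
    · intro h z
      have := h (T.rsm r⁻¹ z)
      rwa [hmu, lsm_mul, rsm_mul, rsm_rsm_inv] at this
    · intro h z
      rw [hmu, lsm_mul, rsm_mul, h]
  have hcard : Nat.card (rightAnn mu) = Nat.card (rightAnn lam) :=
    Nat.card_congr ⟨fun x => ⟨T.lsm s x.1, (h1 _).1 x.2⟩,
      fun x => ⟨T.lsm s⁻¹ x.1, (h1 _).2 (by rw [lsm_lsm_inv]; exact x.2)⟩,
      fun x => Subtype.ext (T.lsm_inv_lsm s x.1), fun x => Subtype.ext (T.lsm_lsm_inv s x.1)⟩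
  rw [annInd, annInd, hcard, ← conjSum_conj (T.annChar ε A θ lam) s⁻¹]
  congr 2
  funext g
  rw [inv_inv]
  by_cases hg : g.fst ∈ A
  · set y := s * g * s⁻¹ with hy
    have hgy : g = s⁻¹ * y * s := by rw [hy]; group
    have hy1 : y.fst = g.fst := T.conj_fst' s g
    have h2 : T.lsm s g.snd = T.rsm s y.snd := by
      have := T.conj_snd_of_comm s y (by rw [hy1]; exact hs _ hg)
      rw [← hgy] at this
      rw [this, lsm_lsm_inv]
    have h3 : g.snd ∈ rightAnn mu ↔ y.snd ∈ rightAnn lam := by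
      rw [h1, h2, rsm_mem_rightAnn_iff]
    rw [annChar, annChar, hy1]
    by_cases hR : y.snd ∈ rightAnn lam
    · rw [if_pos ⟨hg, h3.2 hR⟩, if_pos ⟨hg, hR⟩]
      congr 2
      -- On the product of `y.snd` and s, the factors r and s⁻¹ differ only by terms that lam kills,
      -- because their H-components agree.
      have hw : T.rsm s y.snd ∈ rightAnn lam := (T.rsm_mem_rightAnn_iff s).2 hR
      rw [hmu, h2]
      conv_rhs => rw [← T.rsm_inv_rsm s y.snd]
      rw [T.rsm_apply r, T.rsm_apply s⁻¹, map_add, map_add, hw, hw, hr, inv_fst]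
    · rw [if_neg fun h => hR (h3.1 h.2), if_neg fun h => hR h.2]
  · rw [annChar, annChar, conj_fst', if_neg fun h => hg h.1, if_neg fun h => hg h.1]

theorem sum_monoidHom_apply {Q : Type*} [CommGroup Q] [Finite Q] [Fintype (Q →* ℂˣ)] (q : Q)
    [Decidable (q = 1)] :
    ∑ ψ : Q →* ℂˣ, (ψ q : ℂ) = if q = 1 then (Nat.card Q : ℂ) else 0 := by
  split_ifs with h
  · have : Nat.card (Q →* ℂˣ) = Nat.card Q := CommGroup.card_monoidHom_of_hasEnoughRootsOfUnity Q ℂ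
    rw [← this, Nat.card_eq_fintype_card]
    simp [h]
  · obtain ⟨χ, hχ⟩ := CommGroup.exists_apply_ne_one_of_hasEnoughRootsOfUnity Q ℂ h
    have h1 : ∑ ψ : Q →* ℂˣ, (ψ q : ℂ) = χ q * ∑ ψ : Q →* ℂˣ, (ψ q : ℂ) := by
      rw [Finset.mul_sum]
      refine (Fintype.sum_equiv (Equiv.mulLeft χ) _ _ fun ψ => ?_).symm
      simp
    have h2 : (χ q : ℂ) ≠ 1 := fun h => hχ (Units.ext h)
    by_contra h3
    exact h2 (mul_right_cancel₀ h3 (by rw [← h1, one_mul]))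

/-- Orthogonality on B/A: the sum of θψ over the characters ψ of B/A is |B/A| θ on A and 0 on the
rest of B. -/
theorem annInd_mem_of_le (ε : AddChar k ℂ) {A B : Subgroup H} (hAB : A ≤ B)
    (lam : Module.Dual k J) (C : Submodule ℕ (T.Grp → ℂ))
    (hC : ∀ θ : H →* ℂˣ, T.annInd ε B θ lam ∈ C) (θ : H →* ℂˣ) : T.annInd ε A θ lam ∈ C := by
  classical
  let Q := B ⧸ A.subgroupOf B
  have := Fintype.ofFinite (Q →* ℂˣ)
  have hext : ∀ ψ : Q →* ℂˣ, ∃ χ : H →* ℂˣ, ∀ b : B, χ b = ψ (b : Q) := fun ψ => by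
    obtain ⟨χ, hχ⟩ := MonoidHom.domRestrict_surjective (M := ℂ) B
      (ψ.comp (QuotientGroup.mk' (A.subgroupOf B)))
    exact ⟨χ, fun b => DFunLike.congr_fun hχ b⟩
  choose ext hext using hext
  have key : T.annInd ε A θ lam = ∑ ψ : Q →* ℂˣ, T.annInd ε B (θ * ext ψ) lam := by
    have hQ : Nat.card B = Nat.card Q * Nat.card A := by
      rw [Subgroup.card_eq_card_quotient_mul_card_subgroup (A.subgroupOf B),
        Nat.card_congr (Subgroup.subgroupOfEquivOfLe hAB).toEquiv]
    have hQ0 : (Nat.card Q : ℂ) ≠ 0 := Nat.cast_ne_zero.2 Nat.card_pos.ne'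
    have h1 : (fun g => ∑ ψ : Q →* ℂˣ, T.annChar ε B (θ * ext ψ) lam g) =
        fun g => (Nat.card Q : ℂ) * T.annChar ε A θ lam g := by
      funext g
      by_cases hg : g.fst ∈ B ∧ g.snd ∈ rightAnn lam
      · have h2 : ∀ ψ : Q →* ℂˣ, T.annChar ε B (θ * ext ψ) lam g =
            (θ g.fst * ε (lam g.snd) : ℂ) * (ψ ((⟨g.fst, hg.1⟩ : B) : Q) : ℂ) := fun ψ => by
          rw [annChar, if_pos hg, ← hext, MonoidHom.mul_apply, Units.val_mul]
          ring
        have h3 : ((⟨g.fst, hg.1⟩ : B) : Q) = 1 ↔ g.fst ∈ A := by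
          rw [QuotientGroup.eq_one_iff, Subgroup.mem_subgroupOf]
        rw [Finset.sum_congr rfl fun ψ _ => h2 ψ, ← Finset.mul_sum, sum_monoidHom_apply, annChar]
        by_cases hA : g.fst ∈ A
        · rw [if_pos (h3.2 hA), if_pos ⟨hA, hg.2⟩, mul_comm]
        · rw [if_neg fun h => hA (h3.1 h), if_neg fun h => hA h.1, mul_zero, mul_zero]
      · rw [annChar, if_neg fun h => hg ⟨hAB h.1, h.2⟩, mul_zero]
        exact Finset.sum_eq_zero fun ψ _ => by rw [annChar, if_neg hg]
    simp only [annInd]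
    rw [← Finset.smul_sum, ← conjSum_sum, h1, conjSum_const_mul, smul_smul, hQ]
    congr 1
    push_cast
    field_simp
  rw [key]
  exact Submodule.sum_mem _ fun ψ _ => hC _

/-- Induction on the size of the ideal of kH generated by e. A nonregular orbit contains some mu in
J_f^* with f strictly smaller; `annInd_twist` replaces lam by mu, and H(e) ≤ H(f) allows passage to
f. -/
theorem annInd_idemStab_mem_span [Finite k] [SMulCommClass k J J] (ε : AddChar k ℂ)
    {e : MonoidAlgebra k H} (he : IsIdempotentElem e) {lam : Module.Dual k J}
    (hlam : lam ∈ T.dualCorner e) (θ : H →* ℂˣ) :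
    T.annInd ε (idemStab e) θ lam ∈ Submodule.span ℕ (T.supercharacters ε) := by
  have hfin : Finite (MonoidAlgebra k H) := Module.finite_of_finite k
  induction hn : Nat.card {x : MonoidAlgebra k H // x * e = x} using Nat.strong_induction_on
    generalizing e lam θ with
  | _ n ih =>
  by_cases hreg : T.IsRegular e lam
  · refine Submodule.subset_span ⟨e, θ.comp (idemStab e).subtype, lam, hlam, he, hreg, ?_⟩
    rw [inducedChar_linChar]
  · rw [IsRegular] at hreg
    push Not at hreg
    obtain ⟨f, hf, hfe, hne, hdisj⟩ := hreg
    obtain ⟨mu, ⟨t, u, hu, v, hv, hmu⟩, hmuf⟩ := Set.not_disjoint_iff.1 hdisj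
    have hlt : Nat.card {x : MonoidAlgebra k H // x * f = x} < n := by
      rw [← hn]
      refine Set.Finite.card_lt_card (Set.toFinite {x : MonoidAlgebra k H | x * e = x})
        ⟨fun x (hx : x * f = x) => ?_, fun h => hne ?_⟩
      · change x * e = x
        rw [← hx, mul_assoc, hfe]
      · have h1 : e * f = e := h he
        rw [← hfe, mul_comm, h1]
    -- Here s = t(1 + u) and r = (1 + v)t⁻¹. The commutation condition holds because H(e) fixes u ∈
    -- eJe from both sides.
    rw [← T.annInd_twist ε (idemStab e) θ (lam := lam) (mu := mu) ⟨t, T.left t u⟩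
      ⟨t⁻¹, T.right t⁻¹ v⟩]
    · exact T.annInd_mem_of_le ε (idemStab_mono hfe) mu _ (fun θ' => ih _ hlt hf hmuf θ' rfl) θ
    · intro h hh
      change T.left h (T.left t u) = T.right h (T.left t u)
      rw [left_left, mul_comm, ← left_left, T.left_corner hu hh, ← T.left_right,
        T.right_corner hu hh]
    · rfl
    · intro x
      rw [hmu, T.left_right, rsm_apply, lsm_apply]
      congr 1
      simp only [map_add, T.left_mul, ← T.right_mul, add_mul, mul_assoc]
      abel

/-- With e the average of A, invariance puts lam in J_e^*, and A ≤ H(e). -/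
theorem annInd_mem_span [Finite k] [SMulCommClass k J J] (ε : AddChar k ℂ) {A : Subgroup H}
    {lam : Module.Dual k J} (hlam : T.BiInv A lam) (θ : H →* ℂˣ) :
    T.annInd ε A θ lam ∈ Submodule.span ℕ (T.supercharacters ε) :=
  have := Fintype.ofFinite A
  T.annInd_mem_of_le ε (le_idemStab_avgIdem A) lam _ (fun θ' =>
    T.annInd_idemStab_mem_span ε (T.isIdempotentElem_avgIdem A) (T.mem_dualCorner_avgIdem hlam)
      θ') θ

/-- Characters of a subgroup of a finite abelian group extend, so θ may be taken on all of H; the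
same θ then serves every subgroup that occurs. -/
theorem exists_annInd_of_mem_supercharacters (ε : AddChar k ℂ) {χ : T.Grp → ℂ}
    (hχ : χ ∈ T.supercharacters ε) : ∃ (A : Subgroup H) (θ : H →* ℂˣ) (lam : Module.Dual k J),
      T.BiInv A lam ∧ χ = T.annInd ε A θ lam := by
  obtain ⟨e, θ, lam, hlam, -, -, rfl⟩ := hχ
  obtain ⟨θ', rfl⟩ := MonoidHom.domRestrict_surjective (M := ℂ) (idemStab e) θ
  exact ⟨idemStab e, θ', lam, T.biInv_idemStab hlam, T.inducedChar_linChar ε e θ' lam hlam⟩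

end TriangularData

/-! ### Conjugate forms, and restriction from H + J to H' + J -/

namespace TriangularData

variable {k H J : Type*} [Field k] [CommGroup H] [NonUnitalRing J] [Module k J]

section ConjDual

variable [IsScalarTower k J J] [SMulCommClass k J J] (T : TriangularData k H J)

/-- The form `x ↦ lam (s⁻¹xs)`. -/
noncomputable def conjDual (s : T.Grp) (lam : Module.Dual k J) : Module.Dual k J :=
  lam ∘ₗ T.lsm s⁻¹ ∘ₗ T.rsm s

theorem conjDual_apply (s : T.Grp) (lam : Module.Dual k J) (x : J) :
    T.conjDual s lam x = lam (T.lsm s⁻¹ (T.rsm s x)) := rfl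

theorem mem_rightAnn_conjDual (s : T.Grp) (lam : Module.Dual k J) (x : J) :
    x ∈ rightAnn (T.conjDual s lam) ↔ T.lsm s⁻¹ (T.rsm s x) ∈ rightAnn lam := by
  rw [T.lsm_rsm]
  constructor
  · intro h z
    rw [← T.mul_lsm]
    have := h (T.rsm s⁻¹ (T.lsm s z))
    rwa [conjDual_apply, rsm_mul, rsm_rsm_inv, lsm_mul] at this
  · intro h z
    rw [conjDual_apply, rsm_mul, lsm_mul, ← T.lsm_lsm_inv s (T.rsm s z), T.mul_lsm, h]

/-- The condition says that s commutes in G with B, so conjugation by s commutes with both actions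
of B on J. -/
theorem BiInv.conjDual {T : TriangularData k H J} {B : Subgroup H} {lam : Module.Dual k J}
    (hlam : T.BiInv B lam) {s : T.Grp} (hs : ∀ h ∈ B, T.left h s.snd = T.right h s.snd) :
    T.BiInv B (T.conjDual s lam) := by
  intro h hh x
  have hc : s * ⟨h, 0⟩ = ⟨h, 0⟩ * s := by
    ext
    · simp [mul_comm]
    · simp [hs h hh]
  have hc' : s⁻¹ * ⟨h, 0⟩ = ⟨h, 0⟩ * s⁻¹ := by
    rw [inv_mul_eq_iff_eq_mul, ← mul_assoc, hc, mul_assoc, mul_inv_cancel, mul_one]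
  have hl : ∀ y, T.left h y = T.lsm ⟨h, 0⟩ y := fun y => by simp [lsm_apply]
  have hr : ∀ y, T.right h y = T.rsm ⟨h, 0⟩ y := fun y => by simp [rsm_apply]
  constructor
  · rw [conjDual_apply, hl, ← T.lsm_rsm, T.lsm_lsm, hc', ← T.lsm_lsm, ← hl, (hlam h hh _).1]
    rfl
  · rw [conjDual_apply, hr, T.rsm_rsm, ← hc, ← T.rsm_rsm, T.lsm_rsm, ← hr, (hlam h hh _).2]
    rfl

theorem annChar_conj_of_comm (ε : AddChar k ℂ) (A : Subgroup H) (θ : H →* ℂˣ)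
    (lam : Module.Dual k J) (s g : T.Grp) (h : T.left g.fst s.snd = T.right g.fst s.snd) :
    T.annChar ε A θ lam (s⁻¹ * g * s) = T.annChar ε A θ (T.conjDual s lam) g := by
  have h1 : ((s⁻¹ * g * s).fst ∈ A ∧ (s⁻¹ * g * s).snd ∈ rightAnn lam) ↔
      (g.fst ∈ A ∧ g.snd ∈ rightAnn (T.conjDual s lam)) := by
    rw [conj_fst, T.conj_snd_of_comm s g h, mem_rightAnn_conjDual]
  rw [annChar, annChar]
  by_cases h2 : g.fst ∈ A ∧ g.snd ∈ rightAnn (T.conjDual s lam)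
  · rw [if_pos h2, if_pos (h1.2 h2), conj_fst, T.conj_snd_of_comm s g h, conjDual_apply]
  · rw [if_neg h2, if_neg fun h3 => h2 (h1.1 h3)]

end ConjDual

section Map

variable {H' J' : Type*} [CommGroup H'] [NonUnitalRing J'] [Module k J']

/-- The homomorphism `h + x ↦ f(h) + g(x)`. -/
def grpMap (T' : TriangularData k H' J') (T : TriangularData k H J) [IsScalarTower k J' J']
    [IsScalarTower k J J] (f : H' →* H) (g : J' →ₙₐ[k] J)
    (hl : ∀ h x, g (T'.left h x) = T.left (f h) (g x))
    (hr : ∀ h x, g (T'.right h x) = T.right (f h) (g x)) : T'.Grp →* T.Grp where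
  toFun a := ⟨f a.fst, g a.snd⟩
  map_one' := by ext <;> simp
  map_mul' a b := by ext <;> simp [hl, hr]

variable [IsScalarTower k J J] [SMulCommClass k J J] [IsScalarTower k J' J'] [Finite H] [Finite J]

theorem comp_mem_span_of_supercharacters {T : TriangularData k H J} {G' : Type*}
    (φ : G' → T.Grp) (ε : AddChar k ℂ) (C : Submodule ℕ (G' → ℂ))
    (h : ∀ (A : Subgroup H) (θ : H →* ℂˣ) (lam : Module.Dual k J), T.BiInv A lam →
      T.annInd ε A θ lam ∘ φ ∈ C) {χ : T.Grp → ℂ}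
    (hχ : χ ∈ Submodule.span ℕ (T.supercharacters ε)) : χ ∘ φ ∈ C := by
  have : Submodule.span ℕ (T.supercharacters ε) ≤ C.comap (LinearMap.funLeft ℕ ℂ φ) := by
    rw [Submodule.span_le]
    intro χ hχ
    obtain ⟨A, θ, lam, hlam, rfl⟩ := T.exists_annInd_of_mem_supercharacters ε hχ
    exact h A θ lam hlam
  exact this hχ

variable [Finite H'] [Finite J']

theorem annInd_comp_mem (T' : TriangularData k H' J') (T : TriangularData k H J)
    (φ : T'.Grp →* T.Grp) (ε : AddChar k ℂ) {A : Subgroup H} (θ : H →* ℂˣ)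
    {lam : Module.Dual k J} (hlam : T.BiInv A lam) (C : Submodule ℕ (T'.Grp → ℂ))
    (h : ∀ s : T.Grp, ∃ a : T'.Grp, ∃ r ∈ T.annGroup A lam hlam, ∃ s₀, φ a * s * r = s₀ ∧
      (Nat.card {g : T'.Grp // s₀⁻¹ * φ g * s₀ ∈ T.annGroup A lam hlam} : ℂ)⁻¹ •
        conjSum (fun g => T.annChar ε A θ lam (s₀⁻¹ * φ g * s₀)) ∈ C) :
    T.annInd ε A θ lam ∘ φ ∈ C := by
  have := restrict_conjSum_mem φ (T.annGroup A lam hlam) (T.annChar ε A θ lam)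
    (fun a ha g => T.annChar_conj ε θ hlam ha g) C (fun s => by
      obtain ⟨a, r, hr, s₀, rfl, h⟩ := h s
      exact ⟨a, r, hr, h⟩)
  rw [T.card_annGroup] at this
  exact this

/-- Restriction from `H + J` to `H' + J`. -/
theorem comp_grpMap_id_mem_span [Finite k] (T₀ : TriangularData k H' J) (T : TriangularData k H J)
    (f : H' →* H) (hl : ∀ h x, T₀.left h x = T.left (f h) x)
    (hr : ∀ h x, T₀.right h x = T.right (f h) x) (ε : AddChar k ℂ) {χ : T.Grp → ℂ}
    (hχ : χ ∈ Submodule.span ℕ (T.supercharacters ε)) :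
    χ ∘ grpMap T₀ T f (NonUnitalAlgHom.id k J) hl hr ∈
      Submodule.span ℕ (T₀.supercharacters ε) := by
  refine comp_mem_span_of_supercharacters _ ε _ (fun A θ lam hlam => ?_) hχ
  refine annInd_comp_mem T₀ T _ ε θ hlam _ fun s => ?_
  -- The image of H' + J contains 1 + J, so s may be replaced by its H-component, for which the
  -- commutation condition is trivial.
  let s₀ : T.Grp := ⟨s.fst, 0⟩
  have hs₀ : ∀ h, T.left h s₀.snd = T.right h s₀.snd := fun h => by simp [s₀]
  refine ⟨⟨1, (s₀ * s⁻¹).snd⟩, 1, one_mem _, s₀, ?_, ?_⟩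
  · have : grpMap T₀ T f (NonUnitalAlgHom.id k J) hl hr ⟨1, (s₀ * s⁻¹).snd⟩ = s₀ * s⁻¹ := by
      ext
      · change f 1 = _
        rw [mul_fst, inv_fst, map_one, mul_inv_cancel]
      · rfl
    rw [this, inv_mul_cancel_right, mul_one]
  · have hB : T₀.BiInv (A.comap f) (T.conjDual s₀ lam) := fun h hh x => by
      rw [hl, hr]
      exact hlam.conjDual (fun h _ => hs₀ h) _ hh x
    have hmem := T₀.annInd_mem_span ε hB (θ.comp f)
    have h1 : (fun g => T.annChar ε A θ lam
        (s₀⁻¹ * grpMap T₀ T f (NonUnitalAlgHom.id k J) hl hr g * s₀)) =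
        T₀.annChar ε (A.comap f) (θ.comp f) (T.conjDual s₀ lam) := by
      funext g
      rw [T.annChar_conj_of_comm _ _ _ _ _ _ (hs₀ _)]
      rfl
    have h2 : Nat.card {g : T₀.Grp //
        s₀⁻¹ * grpMap T₀ T f (NonUnitalAlgHom.id k J) hl hr g * s₀ ∈ T.annGroup A lam hlam} =
        Nat.card (A.comap f) * Nat.card (rightAnn (T.conjDual s₀ lam)) := by
      refine Eq.trans ?_
        (T₀.card_subtype_grp (· ∈ A.comap f) (· ∈ rightAnn (T.conjDual s₀ lam)))
      refine Nat.card_congr (Equiv.subtypeEquivRight fun g => ?_)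
      rw [mem_annGroup, conj_fst, T.conj_snd_of_comm _ _ (hs₀ _), ← mem_rightAnn_conjDual]
      rfl
    rw [h1, h2]
    exact hmem

end Map

end TriangularData

/-! ### Twisted forms on a subalgebra containing all products -/

namespace TriangularData

variable {k H J J' : Type*} [Field k] [CommGroup H] [NonUnitalRing J] [Module k J]
  [NonUnitalRing J'] [Module k J']

section Twist

variable [IsScalarTower k J J] [SMulCommClass k J J] [IsScalarTower k J' J']
  [SMulCommClass k J' J']

/-- The form `w ↦ mu (w(1 + z))` on a subalgebra. -/
def twistDual (g : J' →ₙₐ[k] J) (mu : Module.Dual k J) (z : J) : Module.Dual k J' where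
  toFun w := mu (g w + g w * z)
  map_add' a b := by rw [← map_add]; congr 1; rw [map_add, add_mul]; abel
  map_smul' c a := by
    rw [RingHom.id_apply, ← map_smul, map_smul, smul_mul_assoc, smul_add]

theorem twistDual_apply (g : J' →ₙₐ[k] J) (mu : Module.Dual k J) (z : J) (w : J') :
    twistDual g mu z w = mu (g w + g w * z) := rfl

theorem twistDual_mul (g : J' →ₙₐ[k] J) (mu : Module.Dual k J) (z : J) (x y : J') :
    twistDual g mu z (x * y) = mu (g x * (g y + g y * z)) := by
  rw [twistDual_apply, map_mul, mul_add, mul_assoc]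

theorem mem_rightAnn_twistDual_zero {g : J' →ₙₐ[k] J} {mu : Module.Dual k J} {x : J'} :
    x ∈ rightAnn (twistDual g mu 0) ↔ ∀ w, mu (g x * g w) = 0 := by
  simp [mem_rightAnn, twistDual_mul]

/-- The map w ↦ w + wz sends the image of g onto itself: wz and the correction in the inverse are
products, hence in the image. -/
theorem rightAnn_twistDual (T : TriangularData k H J) {g : J' →ₙₐ[k] J}
    (hsq : ∀ x y : J, ∃ w, g w = x * y) (mu : Module.Dual k J) (z : J) :
    rightAnn (twistDual g mu z) = rightAnn (twistDual g mu 0) := by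
  ext x
  rw [mem_rightAnn_twistDual_zero]
  constructor
  · intro h w
    obtain ⟨c, hc⟩ := T.exists_add_mul_eq z (g w)
    obtain ⟨d, hd⟩ := hsq c z
    have := h (w - d)
    rw [twistDual_mul, map_sub, hd, ← hc, add_sub_cancel_right, hc] at this
    exact this
  · intro h w
    obtain ⟨d, hd⟩ := hsq (g w) z
    rw [twistDual_mul, ← hd, ← map_add, h]

/-- The map `z ↦ (y ↦ mu (yz))`. -/
def mulPairing (g : J' →ₙₐ[k] J) (mu : Module.Dual k J) (R : Submodule k J') :
    J →ₗ[k] Module.Dual k R :=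
  LinearMap.mk₂ k (fun z y => mu (g y * z)) (fun a b y => by rw [mul_add, map_add])
    (fun c a y => by rw [mul_smul_comm, map_smul])
    (fun a x y => by rw [Submodule.coe_add, map_add, add_mul, map_add])
    (fun c a y => by rw [Submodule.coe_smul, map_smul, smul_mul_assoc, map_smul])

variable (T' : TriangularData k H J') (T : TriangularData k H J) {g : J' →ₙₐ[k] J}
  (hl : ∀ h x, g (T'.left h x) = T.left h (g x)) (hr : ∀ h x, g (T'.right h x) = T.right h (g x))

-- Only right invariance needs z to be fixed by B, through (wh)z = w(hz).
include hl hr in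
theorem biInv_twistDual {B : Subgroup H} {mu : Module.Dual k J} (hmu : T.BiInv B mu) {z : J}
    (hz : ∀ h ∈ B, T.left h z = z) : T'.BiInv B (twistDual g mu z) := by
  intro h hh w
  constructor
  · rw [twistDual_apply, hl, ← T.left_mul, ← map_add, (hmu h hh _).1, twistDual_apply]
  · rw [twistDual_apply, hr, ← T.mul_left, hz h hh, map_add, (hmu h hh _).2, ← map_add,
      twistDual_apply]

-- Compare J-parts in a(a⁻¹xa) = xa for a = 1 + y. The form kills products whose left factor lies in
-- the annihilator, and by invariance of mu only the perturbation by z distinguishes y from yh,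
-- where h is the H-component of x.
include hl hr in
theorem twistDual_conj (hsq : ∀ x y : J, ∃ w, g w = x * y) {B : Subgroup H}
    {mu : Module.Dual k J} (hmu : T.BiInv B mu) (z : J) {y : J'}
    (hy : y ∈ rightAnn (twistDual g mu 0)) {x : T'.Grp} (hx : x.fst ∈ B)
    (hx' : x.snd ∈ rightAnn (twistDual g mu 0)) :
    twistDual g mu z ((⟨1, y⟩ : T'.Grp)⁻¹ * x * ⟨1, y⟩).snd =
      twistDual g mu z x.snd + (mu (g y * z) - mu (g (T'.right x.fst y) * z)) := by
  set a : T'.Grp := ⟨1, y⟩ with ha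
  have h1 : a * (a⁻¹ * x * a) = x * a := by group
  have h2 := congrArg Grp.snd h1
  rw [T'.mul_snd a, T'.mul_snd x, T'.conj_fst] at h2
  simp only [ha, map_one, Module.End.one_apply] at h2
  rw [← ha] at h2
  have h3 := congrArg (twistDual g mu z) h2
  have h0 : ∀ u ∈ rightAnn (twistDual g mu 0), ∀ v, twistDual g mu z (u * v) = 0 := by
    intro u hu v
    rw [← rightAnn_twistDual T hsq mu z] at hu
    exact hu v
  simp only [map_add] at h3
  rw [h0 y hy, h0 _ hx'] at h3
  have h4 : twistDual g mu z (T'.left x.fst y) = mu (g y) + mu (g y * z) := by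
    rw [twistDual_apply, hl, ← T.left_mul, ← map_add, (hmu _ hx _).1, map_add]
  have h5 : twistDual g mu z (T'.right x.fst y) = mu (g y) + mu (g (T'.right x.fst y) * z) := by
    rw [twistDual_apply, map_add, hr, (hmu _ hx _).2]
  rw [h4, h5] at h3
  linear_combination h3

variable [Finite H] [Finite J']

-- Averaging over conjugation by 1 + y, with y in the annihilator R, does not change `conjSum`. By
-- `twistDual_conj` this produces, at H-component h, the sum over R of ε(mu(yz) - mu((yh)z)), which
-- vanishes unless h stabilizes the form y ↦ mu(yz). Only B' survives.
include hl hr in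
theorem conjSum_annChar_twistDual (hsq : ∀ x y : J, ∃ w, g w = x * y) {ε : AddChar k ℂ}
    (hε : ε ≠ 1) {B B' : Subgroup H} (hBB : B' ≤ B) (θ : H →* ℂˣ) {mu : Module.Dual k J}
    (hmu : T.BiInv B mu) (z : J)
    (hB' : ∀ h ∈ B, h ∈ B' ↔ ∀ y ∈ rightAnn (twistDual g mu 0),
      mu (g (T'.right h y) * z) = mu (g y * z)) :
    conjSum (T'.annChar ε B θ (twistDual g mu z)) =
      conjSum (T'.annChar ε B' θ (twistDual g mu z)) := by
  classical
  set R := rightAnn (twistDual g mu 0) with hR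
  have := Fintype.ofFinite R
  have hRz : rightAnn (twistDual g mu z) = R := rightAnn_twistDual T hsq mu z
  have hinv : T'.BiInv B (twistDual g mu 0) :=
    biInv_twistDual T' T hl hr hmu fun h _ => map_zero _
  have hcard : (Nat.card R : ℂ) ≠ 0 := Nat.cast_ne_zero.2 Nat.card_pos.ne'
  have hpt : ∀ x : T'.Grp, ∑ y : R, T'.annChar ε B θ (twistDual g mu z)
      ((⟨1, y⟩ : T'.Grp)⁻¹ * x * ⟨1, y⟩) =
      (Nat.card R : ℂ) * T'.annChar ε B' θ (twistDual g mu z) x := by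
    intro x
    by_cases hx : x.fst ∈ B ∧ x.snd ∈ R
    · let d : R →ₗ[k] k := mulPairing g mu R z -
        mulPairing g mu R z ∘ₗ (T'.right x.fst).restrict fun y hy => T'.right_mem_rightAnn hy _
      have hd : ∀ y : R, d y = mu (g y * z) - mu (g (T'.right x.fst y) * z) := fun y => rfl
      have hd0 : d = 0 ↔ x.fst ∈ B' := by
        rw [hB' _ hx.1]
        constructor
        · intro h y hy
          have := LinearMap.congr_fun h ⟨y, hy⟩
          rw [hd, LinearMap.zero_apply, sub_eq_zero] at this
          exact this.symm
        · intro h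
          ext y
          rw [hd, LinearMap.zero_apply, sub_eq_zero, h y.1 y.2]
      have h1 : ∀ y : R, T'.annChar ε B θ (twistDual g mu z)
          ((⟨1, y⟩ : T'.Grp)⁻¹ * x * ⟨1, y⟩) =
          (θ x.fst * ε (twistDual g mu z x.snd) : ℂ) * ε (d y) := by
        intro y
        have hya : (⟨1, y⟩ : T'.Grp) ∈ T'.annGroup B _ hinv := ⟨one_mem _, y.2⟩
        have hxa : x ∈ T'.annGroup B _ hinv := hx
        have hc := mul_mem (mul_mem (inv_mem hya) hxa) hya
        rw [mem_annGroup, ← hR] at hc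
        rw [annChar, if_pos (by rw [hRz]; exact hc), T'.conj_fst,
          twistDual_conj T' T hl hr hsq hmu z y.2 hx.1 hx.2, AddChar.map_add_eq_mul, hd, mul_assoc]
      rw [Finset.sum_congr rfl fun y _ => h1 y, ← Finset.mul_sum, sum_addChar_linear hε, annChar,
        hRz]
      by_cases hxB : x.fst ∈ B'
      · rw [if_pos (hd0.2 hxB), if_pos ⟨hxB, hx.2⟩, mul_comm]
      · rw [if_neg fun h => hxB (hd0.1 h), if_neg fun h => hxB h.1, mul_zero, mul_zero]
    · rw [annChar, hRz, if_neg fun h => hx ⟨hBB h.1, h.2⟩, mul_zero]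
      refine Finset.sum_eq_zero fun y _ => ?_
      rw [annChar, hRz]
      refine if_neg fun h => hx ?_
      have hya : (⟨1, y⟩ : T'.Grp) ∈ T'.annGroup B _ hinv := ⟨one_mem _, y.2⟩
      have hxa : (⟨1, y⟩ : T'.Grp)⁻¹ * x * ⟨1, y⟩ ∈ T'.annGroup B _ hinv := h
      have := mul_mem (mul_mem hya hxa) (inv_mem hya)
      have hxe : (⟨1, y⟩ : T'.Grp) * ((⟨1, y⟩ : T'.Grp)⁻¹ * x * ⟨1, y⟩) * (⟨1, y⟩ : T'.Grp)⁻¹ = x := by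
        group
      rwa [hxe] at this
  have h2 := congrArg conjSum (funext hpt)
  rw [conjSum_sum, conjSum_const_mul] at h2
  simp only [conjSum_conj] at h2
  rw [Finset.sum_const, Finset.card_univ, ← Nat.card_eq_fintype_card,
    ← Nat.cast_smul_eq_nsmul ℂ] at h2
  exact smul_right_injective _ hcard h2

-- Only the form y ↦ mu(yz) on the annihilator matters, and B fixes it. Replacing z by its average
-- over B keeps this form and makes the twisted form B-invariant, so `annInd_mem_span` applies.
include hl hr in
theorem annInd_twistDual_mem_span [Finite k]
    (hsq : ∀ x y : J, ∃ w, g w = x * y) (ε : AddChar k ℂ) {B : Subgroup H} (θ : H →* ℂˣ)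
    {mu : Module.Dual k J} (hmu : T.BiInv B mu) (z : J)
    (hB : ∀ h ∈ B, ∀ y ∈ rightAnn (twistDual g mu 0),
      mu (g (T'.right h y) * z) = mu (g y * z)) :
    T'.annInd ε B θ (twistDual g mu z) ∈ Submodule.span ℕ (T'.supercharacters ε) := by
  have := Fintype.ofFinite B
  have hB0 : (Nat.card B : k) ≠ 0 := T.card_subgroup_ne_zero B
  let z' : J := (Nat.card B : k)⁻¹ • ∑ h : B, T.left h z
  have hz' : ∀ h ∈ B, T.left h z' = z' := by
    intro h hh
    rw [map_smul, map_sum]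
    congr 1
    refine Fintype.sum_equiv (Equiv.mulLeft (⟨h, hh⟩ : B)) _ _ fun b => ?_
    rw [left_left]
    rfl
  have hzz : ∀ y ∈ rightAnn (twistDual g mu 0), mu (g y * z') = mu (g y * z) := by
    intro y hy
    have h1 : ∀ h : B, mu (g y * T.left h z) = mu (g y * z) := fun h => by
      rw [T.mul_left, ← hr, hB h h.2 y hy]
    rw [mul_smul_comm, Finset.mul_sum, map_smul, map_sum, Finset.sum_congr rfl fun h _ => h1 h,
      Finset.sum_const, Finset.card_univ, ← Nat.card_eq_fintype_card,
      ← Nat.cast_smul_eq_nsmul k, smul_smul, inv_mul_cancel₀ hB0, one_smul]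
  have h2 : T'.annInd ε B θ (twistDual g mu z) = T'.annInd ε B θ (twistDual g mu z') := by
    rw [annInd, annInd, rightAnn_twistDual T hsq mu z, rightAnn_twistDual T hsq mu z']
    congr 2
    funext x
    rw [annChar, annChar, rightAnn_twistDual T hsq mu z, rightAnn_twistDual T hsq mu z']
    by_cases hx : x.fst ∈ B ∧ x.snd ∈ rightAnn (twistDual g mu 0)
    · rw [if_pos hx, if_pos hx, twistDual_apply, twistDual_apply, mu.map_add, mu.map_add, hzz _ hx.2]
    · rw [if_neg hx, if_neg hx]
  rw [h2]
  exact T'.annInd_mem_span ε (biInv_twistDual T' T hl hr hmu hz') θ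

end Twist

end TriangularData

/-! ### Fourier expansion over the perturbations, and its B-orbits -/

namespace TriangularData

variable {k H J J' : Type*} [Field k] [CommGroup H] [NonUnitalRing J] [Module k J]
  [NonUnitalRing J'] [Module k J']

/-- Sum ε(f y) over V × R in both orders. -/
theorem card_mul_card_coannihilator {R : Type*} [AddCommGroup R] [Module k R] [Finite R]
    {ε : AddChar k ℂ} (hε : ε ≠ 1) (V : Submodule k (Module.Dual k R)) [Finite V] :
    Nat.card V * Nat.card {y : R // ∀ f ∈ V, f y = 0} = Nat.card R := by
  classical
  have := Fintype.ofFinite R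
  have := Fintype.ofFinite V
  have h1 : ∑ f : V, ∑ y : R, ε (f.1 y) = Nat.card R := by
    simp_rw [sum_addChar_linear hε]
    rw [Finset.sum_ite, Finset.sum_const_zero, add_zero, Finset.sum_const,
      (Finset.card_eq_one (s := Finset.univ.filter fun f : V => f.1 = 0)).2 ⟨0, ?_⟩, one_smul]
    ext f
    simp
  have h2 : ∑ y : R, ∑ f : V, ε (f.1 y) =
      (Nat.card V * Nat.card {y : R // ∀ f ∈ V, f y = 0} : ℕ) := by
    have h3 : ∀ y : R, ∑ f : V, ε (f.1 y) = if ∀ f ∈ V, f y = 0 then (Nat.card V : ℂ) else 0 := by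
      intro y
      have h4 := sum_addChar_linear (k := k) (V := ↥V) hε (Module.Dual.eval k R y ∘ₗ V.subtype)
      have h5 : (Module.Dual.eval k R y ∘ₗ V.subtype : V →ₗ[k] k) = 0 ↔ ∀ f ∈ V, f y = 0 :=
        ⟨fun h f hf => LinearMap.congr_fun h ⟨f, hf⟩, fun h => LinearMap.ext fun f => h f.1 f.2⟩
      simp only [h5] at h4
      exact h4
    rw [Finset.sum_congr rfl fun y _ => h3 y, Finset.sum_ite, Finset.sum_const_zero, add_zero,
      Finset.sum_const, ← Fintype.card_subtype, ← Nat.card_eq_fintype_card, nsmul_eq_mul,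
      mul_comm]
    push_cast
    rfl
  rw [Finset.sum_comm, h1] at h2
  exact_mod_cast h2.symm

theorem annChar_congr [IsScalarTower k J J] (T : TriangularData k H J) (ε : AddChar k ℂ)
    (A : Subgroup H) (θ : H →* ℂˣ) {lam mu : Module.Dual k J} (h : rightAnn lam = rightAnn mu)
    (h' : ∀ x ∈ rightAnn mu, lam x = mu x) :
    T.annChar ε A θ lam = T.annChar ε A θ mu := by
  funext g
  rw [annChar, annChar, h]
  by_cases hg : g.fst ∈ A ∧ g.snd ∈ rightAnn mu
  · rw [if_pos hg, if_pos hg, h' _ hg.2]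
  · rw [if_neg hg, if_neg hg]

variable [IsScalarTower k J J] [SMulCommClass k J J] [IsScalarTower k J' J']
  [SMulCommClass k J' J'] (T' : TriangularData k H J') (T : TriangularData k H J)
  {g : J' →ₙₐ[k] J} (hl : ∀ h x, g (T'.left h x) = T.left h (g x))
  (hr : ∀ h x, g (T'.right h x) = T.right h (g x)) [Finite H] [Finite J']

-- Conjugation by b turns the perturbation y ↦ mu(yz) into y ↦ mu((yb)z), while the B-invariant mu
-- stays.
include hl hr in
theorem conjSum_annChar_twistDual_eq (hsq : ∀ x y : J, ∃ w, g w = x * y) (ε : AddChar k ℂ)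
    {B : Subgroup H} (θ : H →* ℂˣ) {mu : Module.Dual k J} (hmu : T.BiInv B mu) {b : H}
    (hb : b ∈ B) {z z₁ : J} (hz : ∀ y ∈ rightAnn (twistDual g mu 0),
      mu (g y * z₁) = mu (g (T'.right b y) * z)) :
    conjSum (T'.annChar ε B θ (twistDual g mu z₁)) =
      conjSum (T'.annChar ε B θ (twistDual g mu z)) := by
  let a : T'.Grp := ⟨b, 0⟩
  have hinv : T'.BiInv B (twistDual g mu 0) :=
    biInv_twistDual T' T hl hr hmu fun h _ => map_zero _
  have ha : ∀ w, T'.lsm a⁻¹ (T'.rsm a w) = T'.left b⁻¹ (T'.right b w) := by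
    intro w
    have : a⁻¹ = ⟨b⁻¹, 0⟩ := inv_eq_of_mul_eq_one_right (by ext <;> simp [a])
    rw [this, lsm_apply, rsm_apply]
    simp [a]
  have h1 : rightAnn (T'.conjDual a (twistDual g mu z)) = rightAnn (twistDual g mu z₁) := by
    rw [rightAnn_twistDual T hsq mu z₁]
    ext x
    rw [mem_rightAnn_conjDual, ha, rightAnn_twistDual T hsq mu z]
    constructor
    · intro h
      have h2 := T'.left_mem_rightAnn hinv (T'.right_mem_rightAnn h b⁻¹) hb
      rwa [T'.left_right, left_left, mul_inv_cancel, map_one, Module.End.one_apply,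
        right_right, mul_inv_cancel, map_one, Module.End.one_apply] at h2
    · intro h
      exact T'.left_mem_rightAnn hinv (T'.right_mem_rightAnn h b) (inv_mem hb)
  have h2 : ∀ x ∈ rightAnn (twistDual g mu z₁),
      T'.conjDual a (twistDual g mu z) x = twistDual g mu z₁ x := by
    intro x hx
    rw [rightAnn_twistDual T hsq mu z₁] at hx
    rw [conjDual_apply, ha, twistDual_apply, twistDual_apply, hl, ← T.left_mul, ← map_add,
      (hmu _ (inv_mem hb) _).1, map_add, map_add, hz x hx, hr, (hmu b hb _).2]
  rw [← T'.annChar_congr ε B θ h1 h2, ← conjSum_conj (T'.annChar ε B θ (twistDual g mu z)) a]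
  congr 1
  funext x
  rw [T'.annChar_conj_of_comm]
  simp [a]

/-- The elements x with g x ∈ J_{mu,right} form the annihilator in R of the space V of forms y ↦
mu(yz), so their indicator function on R is the average of ε ∘ f over f ∈ V. This expands the
character into twisted ones. For each f, `conjSum_annChar_twistDual` shrinks B to the stabilizer of
f, and the weights left over are those of `orbit_sum_mem`. -/
theorem conjSum_annChar_grpMap_mem_span [Finite J] [Finite k]
    (hsq : ∀ x y : J, ∃ w, g w = x * y) {ε : AddChar k ℂ}
    (hε : ε ≠ 1) {B : Subgroup H} (θ : H →* ℂˣ) {mu : Module.Dual k J} (hmu : T.BiInv B mu) :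
    ((Nat.card B * Nat.card {x : J' // g x ∈ rightAnn mu} : ℕ) : ℂ)⁻¹ •
      conjSum (fun x => T.annChar ε B θ mu (grpMap T' T (MonoidHom.id H) g hl hr x)) ∈
    Submodule.span ℕ (T'.supercharacters ε) := by
  classical
  set R := rightAnn (twistDual g mu 0) with hR
  have hRz : ∀ z, rightAnn (twistDual g mu z) = R := rightAnn_twistDual T hsq mu
  let Φ := mulPairing g mu R
  let V := LinearMap.range Φ
  have : Finite V := Finite.of_surjective _ Φ.surjective_rangeRestrict
  have := Fintype.ofFinite V
  have hmaps : ∀ b : B, ∀ y ∈ R, T'.right b y ∈ R := fun b y hy => T'.right_mem_rightAnn hy _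
  -- The action (bf)(y) = f(yb) corresponds to z ↦ bz, since (yb)z = y(bz).
  let _ : MulAction B V :=
    { smul := fun b f => ⟨f.1 ∘ₗ (T'.right b).restrict (hmaps b), by
        obtain ⟨z, hz⟩ := f.2
        refine ⟨T.left b z, LinearMap.ext fun y => ?_⟩
        rw [← hz]
        change mu (g y * T.left b z) = mu (g (T'.right b y) * z)
        rw [T.mul_left, hr]⟩
      one_smul := fun f => Subtype.ext (LinearMap.ext fun y => by
        refine congrArg f.1 (Subtype.ext ?_)
        change T'.right 1 y = y
        rw [map_one, Module.End.one_apply])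
      mul_smul := fun b c f => Subtype.ext (LinearMap.ext fun y => by
        refine congrArg f.1 (Subtype.ext ?_)
        change T'.right (b * c : H) y = T'.right c (T'.right b y)
        rw [right_right]) }
  have hsm : ∀ (b : B) (f : V) (y : R), (b • f).1 y = f.1 ⟨T'.right b y, hmaps b y y.2⟩ :=
    fun b f y => rfl
  have hsec : ∀ f : V, ∃ z : J, ∀ y : R, mu (g y * z) = f.1 y := fun f => by
    obtain ⟨z, hz⟩ := f.2
    exact ⟨z, fun y => LinearMap.congr_fun hz y⟩
  -- The choice of ζ need not be equivariant: `conjSum_annChar_twistDual_eq` only compares the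
  -- induced forms on R.
  choose ζ hζ using hsec
  have hst : ∀ (f : V) (h : H) (hh : h ∈ B),
      h ∈ (MulAction.stabilizer B f).map B.subtype ↔
      ∀ y ∈ R, mu (g (T'.right h y) * ζ f) = mu (g y * ζ f) := by
    intro f h hh
    have h1 : h ∈ (MulAction.stabilizer B f).map B.subtype ↔ (⟨h, hh⟩ : B) • f = f := by
      constructor
      · rintro ⟨b, hb, rfl⟩
        exact hb
      · intro hb
        exact ⟨⟨h, hh⟩, hb, rfl⟩
    rw [h1]
    constructor
    · intro hf y hy
      rw [hζ f ⟨y, hy⟩, hζ f ⟨T'.right h y, hmaps ⟨h, hh⟩ y hy⟩]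
      conv_rhs => rw [← hf]
      rfl
    · intro hf
      refine Subtype.ext (LinearMap.ext fun y => ?_)
      rw [hsm, ← hζ, ← hζ, ← hf y y.2]
  have hcst : ∀ f : V, Nat.card ((MulAction.stabilizer B f).map B.subtype) =
      Nat.card (MulAction.stabilizer B f) := fun f =>
    Nat.card_congr (Subgroup.equivMapOfInjective _ _ B.subtype_injective).symm.toEquiv
  have key := orbit_sum_mem (B := B) (Submodule.span ℕ (T'.supercharacters ε))
    (fun f : V => ((Nat.card (MulAction.stabilizer B f) * Nat.card R : ℕ) : ℂ)⁻¹ •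
      conjSum (T'.annChar ε B θ (twistDual g mu (ζ f)))) (by
    intro b f
    have h1 : MulAction.stabilizer B (b • f) = MulAction.stabilizer B f := by
      ext c
      rw [MulAction.mem_stabilizer_iff, MulAction.mem_stabilizer_iff, smul_smul, mul_comm,
        ← smul_smul, smul_left_cancel_iff]
    change ((Nat.card (MulAction.stabilizer B (b • f)) * Nat.card R : ℕ) : ℂ)⁻¹ • _ = _
    rw [h1]
    congr 1
    refine conjSum_annChar_twistDual_eq T' T hl hr hsq ε θ hmu b.2 fun y hy => ?_
    rw [hζ (b • f) ⟨y, hy⟩, hsm]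
    exact (hζ f ⟨T'.right b y, hmaps b y hy⟩).symm) (by
    intro f
    have h2 : (MulAction.stabilizer B f).map B.subtype ≤ B := Subgroup.map_subtype_le _
    rw [conjSum_annChar_twistDual T' T hl hr hsq hε h2 θ hmu (ζ f) (hst f), ← hcst]
    have h3 := annInd_twistDual_mem_span T' T hl hr hsq ε θ (hmu.mono h2) (ζ f)
      fun h hh => (hst f h (h2 hh)).1 hh
    rwa [annInd, hRz] at h3)
  have hVR : Nat.card V * Nat.card {x : J' // g x ∈ rightAnn mu} = Nat.card R := by
    rw [← card_mul_card_coannihilator (R := R) hε V]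
    congr 1
    have hann : ∀ x, g x ∈ rightAnn mu → x ∈ R := fun x hx => by
      rw [hR, mem_rightAnn_twistDual_zero]
      exact fun w => hx _
    refine Nat.card_congr ⟨fun x => ⟨⟨x.1, hann x.1 x.2⟩, ?_⟩, fun y => ⟨y.1.1, fun z => ?_⟩,
      fun _ => rfl, fun _ => rfl⟩
    · rintro _ ⟨z, rfl⟩
      exact x.2 z
    · exact y.2 (Φ z) ⟨z, rfl⟩
  have hpt : (fun x => ∑ f : V, T'.annChar ε B θ (twistDual g mu (ζ f)) x) = fun x =>
      (Nat.card V : ℂ) * T.annChar ε B θ mu (grpMap T' T (MonoidHom.id H) g hl hr x) := by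
    funext x
    have hxe : T.annChar ε B θ mu (grpMap T' T (MonoidHom.id H) g hl hr x) =
        if x.fst ∈ B ∧ g x.snd ∈ rightAnn mu then (θ x.fst : ℂ) * ε (mu (g x.snd)) else 0 := by
      by_cases h : x.fst ∈ B ∧ g x.snd ∈ rightAnn mu
      · rw [if_pos h]
        exact if_pos h
      · rw [if_neg h]
        exact if_neg h
    rw [hxe]
    by_cases hx : x.fst ∈ B ∧ x.snd ∈ R
    · have h1 : ∀ f : V, T'.annChar ε B θ (twistDual g mu (ζ f)) x =
          ((θ x.fst : ℂ) * ε (mu (g x.snd))) * ε (f.1 ⟨x.snd, hx.2⟩) := by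
        intro f
        rw [annChar, hRz, if_pos hx, twistDual_apply, map_add, AddChar.map_add_eq_mul,
          ← hζ f ⟨x.snd, hx.2⟩, mul_assoc]
      have h2 := sum_addChar_linear (k := k) (V := ↥V) hε
        (Module.Dual.eval k R ⟨x.snd, hx.2⟩ ∘ₗ V.subtype)
      have h3 : (Module.Dual.eval k R ⟨x.snd, hx.2⟩ ∘ₗ V.subtype : V →ₗ[k] k) = 0 ↔
          g x.snd ∈ rightAnn mu := by
        constructor
        · intro h z
          exact LinearMap.congr_fun h ⟨Φ z, z, rfl⟩
        · intro h
          ext ⟨_, z, rfl⟩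
          exact h z
      rw [Finset.sum_congr rfl fun f _ => h1 f, ← Finset.mul_sum]
      have h4 : ∑ f : V, ε (f.1 ⟨x.snd, hx.2⟩) =
          if g x.snd ∈ rightAnn mu then (Nat.card V : ℂ) else 0 := by
        simp only [h3] at h2
        exact h2
      rw [h4]
      by_cases hg : g x.snd ∈ rightAnn mu
      · rw [if_pos hg, if_pos ⟨hx.1, hg⟩, mul_comm]
      · rw [if_neg hg, if_neg fun h => hg h.2, mul_zero, mul_zero]
    · rw [if_neg, mul_zero]
      · exact Finset.sum_eq_zero fun f _ => by rw [annChar, hRz, if_neg hx]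
      · rintro ⟨h1, h2⟩
        exact hx ⟨h1, by rw [hR, mem_rightAnn_twistDual_zero]; exact fun w => h2 _⟩
  convert key using 1
  have hB0 : (Nat.card B : ℂ) ≠ 0 := Nat.cast_ne_zero.2 Nat.card_pos.ne'
  have hV0 : (Nat.card V : ℂ) ≠ 0 := Nat.cast_ne_zero.2 Nat.card_pos.ne'
  have hS0 : ∀ f : V, (Nat.card (MulAction.stabilizer B f) : ℂ) ≠ 0 := fun f =>
    Nat.cast_ne_zero.2 Nat.card_pos.ne'
  have hw : ∀ f : V, (Nat.card (MulAction.stabilizer B f) : ℂ) / Nat.card B *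
      ((Nat.card (MulAction.stabilizer B f) * Nat.card R : ℕ) : ℂ)⁻¹ =
      ((Nat.card B * Nat.card R : ℕ) : ℂ)⁻¹ := fun f => by
    have := hS0 f
    push_cast
    field_simp
  simp only [smul_smul, hw]
  rw [← Finset.smul_sum, ← conjSum_sum, hpt, conjSum_const_mul, smul_smul, ← hVR]
  congr 1
  push_cast
  field_simp

end TriangularData

/-! ### Restriction to H + J' when JJ ⊆ J' -/

namespace TriangularData

section Square

variable {k H J J' : Type*} [Field k] [CommGroup H] [NonUnitalRing J] [Module k J]
  [NonUnitalRing J'] [Module k J'] [IsScalarTower k J J] [SMulCommClass k J J]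
  [IsScalarTower k J' J'] [SMulCommClass k J' J'] [Finite H]

/-- The elements of `A` that centralize `u` modulo `M`. -/
def centralizerMod (T : TriangularData k H J) (A : Subgroup H) (M : Submodule k J)
    (hM : ∀ h ∈ A, ∀ x ∈ M, T.left h x ∈ M) (hM' : ∀ h : H, ∀ x ∈ M, T.right h x ∈ M) (u : J) :
    Subgroup H where
  carrier := {h | h ∈ A ∧ T.left h u - T.right h u ∈ M}
  one_mem' := ⟨one_mem _, by simp⟩
  mul_mem' {a b} ha hb := ⟨mul_mem ha.1 hb.1, by
    have h1 := add_mem (hM a ha.1 _ hb.2) (hM' b _ ha.2)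
    rwa [map_sub, map_sub, left_left, right_right, T.left_right, sub_add_sub_cancel] at h1⟩
  inv_mem' {a} ha := ⟨inv_mem ha.1, by
    have h1 := neg_mem (hM a⁻¹ (inv_mem ha.1) _ (hM' a⁻¹ _ ha.2))
    rwa [map_sub, map_sub, ← T.left_right, left_left, inv_mul_cancel, map_one,
      Module.End.one_apply, right_right, mul_inv_cancel, map_one, Module.End.one_apply,
      neg_sub] at h1⟩

/-- Take v to be the average of huh⁻¹ over A; each conjugate differs from u by (hu - uh)h⁻¹ ∈ M. -/
theorem exists_sub_mem_and_commute (T : TriangularData k H J) {A : Subgroup H}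
    {M : Submodule k J} (hM' : ∀ h : H, ∀ x ∈ M, T.right h x ∈ M) {u : J}
    (hu : ∀ h ∈ A, T.left h u - T.right h u ∈ M) :
    ∃ v, v - u ∈ M ∧ ∀ h ∈ A, T.left h v = T.right h v := by
  have := Fintype.ofFinite A
  refine ⟨(Nat.card A : k)⁻¹ • ∑ h : A, T.left h (T.right h⁻¹ u), ?_, fun h hh => ?_⟩
  · have h1 : u = (Nat.card A : k)⁻¹ • ∑ h : A, u := by
      rw [Finset.sum_const, Finset.card_univ, ← Nat.card_eq_fintype_card,
        ← Nat.cast_smul_eq_nsmul k, smul_smul, inv_mul_cancel₀ (T.card_subgroup_ne_zero A),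
        one_smul]
    have h3 : ∀ x : J, (Nat.card A : k)⁻¹ • x - u =
        (Nat.card A : k)⁻¹ • x - (Nat.card A : k)⁻¹ • ∑ h : A, u := fun x => by rw [← h1]
    rw [h3, ← smul_sub, ← Finset.sum_sub_distrib]
    refine M.smul_mem _ (M.sum_mem fun h _ => ?_)
    have h2 := hM' (h : H)⁻¹ _ (hu h h.2)
    rwa [map_sub, right_right, mul_inv_cancel, map_one, Module.End.one_apply,
      ← T.left_right] at h2
  · rw [map_smul, map_smul, map_sum, map_sum]
    congr 1
    refine Fintype.sum_equiv (Equiv.mulLeft (⟨h, hh⟩ : A)) _ _ fun b => ?_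
    change T.left h (T.left b (T.right b⁻¹ u)) =
      T.right h (T.left (h * b) (T.right (h * b)⁻¹ u))
    rw [left_left, ← T.left_right, right_right, mul_inv_rev, inv_mul_cancel_right]

variable [Finite J] [Finite J'] [Finite k]

/-- Restriction from `H + J` to `H + J'` when `JJ ⊆ J'`. -/
theorem comp_grpMap_mem_span_of_mul_mem (T' : TriangularData k H J') (T : TriangularData k H J)
    {g : J' →ₙₐ[k] J} (hl : ∀ h x, g (T'.left h x) = T.left h (g x))
    (hr : ∀ h x, g (T'.right h x) = T.right h (g x)) (hsq : ∀ x y : J, ∃ w, g w = x * y)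
    {ε : AddChar k ℂ} (hε : ε ≠ 1) {χ : T.Grp → ℂ}
    (hχ : χ ∈ Submodule.span ℕ (T.supercharacters ε)) :
    χ ∘ grpMap T' T (MonoidHom.id H) g hl hr ∈ Submodule.span ℕ (T'.supercharacters ε) := by
  refine comp_mem_span_of_supercharacters _ ε _ (fun A θ lam hlam => ?_) hχ
  refine annInd_comp_mem T' T _ ε θ hlam _ fun s => ?_
  set φ := grpMap T' T (MonoidHom.id H) g hl hr with hφ
  let I : Submodule k J := LinearMap.range (g : J' →ₗ[k] J)
  -- Multiplying 1 + u by 1 + J' from the left and by 1 + J_{lam,right} from the right changes u, up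
  -- to products, by elements of M. As products lie in J', only u modulo M matters.
  let M : Submodule k J := rightAnn lam ⊔ I
  have hM : ∀ h ∈ A, ∀ x ∈ M, T.left h x ∈ M := by
    intro h hh x hx
    obtain ⟨r, hr', _, ⟨w, rfl⟩, rfl⟩ := Submodule.mem_sup.1 hx
    rw [map_add]
    exact add_mem (Submodule.mem_sup_left (T.left_mem_rightAnn hlam hr' hh))
      (Submodule.mem_sup_right ⟨T'.left h w, hl h w⟩)
  have hM' : ∀ h : H, ∀ x ∈ M, T.right h x ∈ M := by
    intro h x hx
    obtain ⟨r, hr', _, ⟨w, rfl⟩, rfl⟩ := Submodule.mem_sup.1 hx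
    rw [map_add]
    exact add_mem (Submodule.mem_sup_left (T.right_mem_rightAnn hr' h))
      (Submodule.mem_sup_right ⟨T'.right h w, hr h w⟩)
  let u : J := T.left s.fst⁻¹ s.snd
  -- By `hmem` below, B is the group of H-components of the intersection.
  let B := T.centralizerMod A M hM hM' u
  have hBA : B ≤ A := fun h hh => hh.1
  obtain ⟨v, hvu, hv⟩ := T.exists_sub_mem_and_commute hM' (A := B) (u := u) fun h hh => hh.2
  obtain ⟨r, hrR, _, ⟨j, rfl⟩, hrj⟩ := Submodule.mem_sup.1 hvu
  let s₀ : T.Grp := ⟨1, v⟩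
  let mu := T.conjDual s₀ lam
  -- The equation is (1 + c)(1 + u)(1 + r) = 1 + v. Its solution lies in J', because v - u - r = g j
  -- and all products do.
  obtain ⟨c, hc⟩ := T.exists_add_mul_eq (r + u + u * r) (v - (r + u + u * r))
  obtain ⟨c, rfl⟩ : c ∈ I := by
    have h1 : c = g j - u * r - c * (r + u + u * r) := by
      rw [eq_sub_iff_add_eq, hc, ← sub_sub, add_comm r u, ← sub_sub, ← hrj]
      change r + g j - r - u * r = _
      abel
    rw [h1]
    exact sub_mem (sub_mem ⟨j, rfl⟩ (hsq _ _)) (hsq _ _)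
  change g c + g c * (r + u + u * r) = _ at hc
  have hs₀ : φ (⟨1, c⟩ * ⟨s.fst⁻¹, 0⟩) * s * ⟨1, r⟩ = s₀ := by
    have h1 : φ (⟨1, c⟩ * ⟨s.fst⁻¹, 0⟩) * s = ⟨1, u + g c + g c * u⟩ := by
      have h2 : φ (⟨1, c⟩ * ⟨s.fst⁻¹, 0⟩) = ⟨1, g c⟩ * ⟨s.fst⁻¹, 0⟩ := by
        rw [map_mul]
        congr 1
        ext
        · rfl
        · exact map_zero g
      have h3 : (⟨s.fst⁻¹, 0⟩ : T.Grp) * s = ⟨1, u⟩ := by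
        ext <;> simp [u]
      rw [h2, mul_assoc, h3]
      ext <;> simp
    rw [h1]
    ext
    · simp [s₀]
    · simp only [mul_snd, map_one, Module.End.one_apply, s₀]
      rw [eq_sub_iff_add_eq] at hc
      rw [← hc]
      simp only [mul_add, add_mul, mul_assoc]
      abel
  have hmem : ∀ x, s₀⁻¹ * φ x * s₀ ∈ T.annGroup A lam hlam ↔
      x.fst ∈ B ∧ g x.snd ∈ rightAnn mu := by
    intro x
    have hx1 : (s₀⁻¹ * φ x * s₀).fst = x.fst := T.conj_fst s₀ (φ x)
    have hsnd : x.fst ∈ B →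
        (s₀⁻¹ * φ x * s₀).snd = T.lsm s₀⁻¹ (T.rsm s₀ (g x.snd)) := fun hx =>
      T.conj_snd_of_comm s₀ (φ x) (hv _ hx)
    rw [mem_annGroup, hx1]
    constructor
    · rintro ⟨hxA, hxR⟩
      have hxB : x.fst ∈ B := by
        refine ⟨hxA, ?_⟩
        -- With h the H-component and w the J-part of `φ x`, comparing J-parts in (1 + v)(h + y) =
        -- (h + w)(1 + v) gives hv - vh = y + vy - w - wv, an element of M.
        have h1 : s₀ * (s₀⁻¹ * φ x * s₀) = φ x * s₀ := by group
        have h2 := congrArg Grp.snd h1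
        rw [T.mul_snd s₀, T.mul_snd (φ x), hx1] at h2
        set y := (s₀⁻¹ * φ x * s₀).snd
        have h3 : y + T.right x.fst v + v * y = T.left x.fst v + g x.snd + g x.snd * v := by
          simpa [s₀, hφ, grpMap] using h2
        have h4 : T.left x.fst v - T.right x.fst v = y + (v * y - g x.snd - g x.snd * v) := by
          rw [sub_eq_iff_eq_add]
          have h5 : T.left x.fst v = y + T.right x.fst v + v * y - g x.snd * v - g x.snd := by
            rw [h3]; abel
          rw [h5]; abel
        have h6 : T.left x.fst v - T.right x.fst v ∈ M := by
          rw [h4]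
          exact add_mem (Submodule.mem_sup_left hxR) (Submodule.mem_sup_right
            (sub_mem (sub_mem (hsq _ _) ⟨_, rfl⟩) (hsq _ _)))
        have h7 := sub_mem h6 (sub_mem (hM _ hxA _ hvu) (hM' x.fst _ hvu))
        rw [map_sub, map_sub] at h7
        convert h7 using 1
        abel
      rw [hsnd hxB] at hxR
      exact ⟨hxB, (T.mem_rightAnn_conjDual _ _ _).2 hxR⟩
    · rintro ⟨hxB, hxR⟩
      rw [hsnd hxB]
      exact ⟨hBA hxB, (T.mem_rightAnn_conjDual _ _ _).1 hxR⟩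
  refine ⟨⟨1, c⟩ * ⟨s.fst⁻¹, 0⟩, ⟨1, r⟩, ⟨one_mem _, hrR⟩, s₀, hs₀, ?_⟩
  have hcard : Nat.card {x : T'.Grp // s₀⁻¹ * φ x * s₀ ∈ T.annGroup A lam hlam} =
      Nat.card B * Nat.card {x : J' // g x ∈ rightAnn mu} := by
    rw [Nat.card_congr (Equiv.subtypeEquivRight hmem)]
    exact T'.card_subtype_grp (· ∈ B) (g · ∈ rightAnn mu)
  have hF : (fun x => T.annChar ε A θ lam (s₀⁻¹ * φ x * s₀)) =
      fun x => T.annChar ε B θ mu (φ x) := by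
    funext x
    by_cases hx : x.fst ∈ B
    · rw [T.annChar_conj_of_comm ε A θ lam s₀ (φ x) (hv _ hx), annChar, annChar]
      by_cases hR : g x.snd ∈ rightAnn mu
      · exact (if_pos ⟨hBA hx, hR⟩).trans (if_pos ⟨hx, hR⟩).symm
      · exact (if_neg fun h => hR h.2).trans (if_neg fun h => hR h.2).symm
    · exact (if_neg fun h => hx ((hmem x).1 h).1).trans (if_neg fun h => hx h.1).symm
  rw [hcard, hF]
  exact conjSum_annChar_grpMap_mem_span T' T hl hr hsq hε θ ((hlam.mono hBA).conjDual hv)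

end Square

end TriangularData

/-! ### The chain from J down to J' -/

namespace TriangularData

section Chain

universe u

variable {k H J J' : Type*} [Field k] [CommGroup H] [NonUnitalRing J] [Module k J]
  [NonUnitalRing J'] [Module k J'] [IsScalarTower k J J] [SMulCommClass k J J]
  [IsScalarTower k J' J'] [SMulCommClass k J' J']

/-- The linear span `JJ` of all products. -/
def mulSpan (k J : Type*) [Field k] [NonUnitalRing J] [Module k J] : Submodule k J :=
  Submodule.span k {z | ∃ x y : J, x * y = z}

theorem mul_mem_mulSpan (x y : J) : x * y ∈ mulSpan k J := Submodule.subset_span ⟨x, y, rfl⟩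

/-- A Nakayama argument: substituting J = J' + J^m into both factors of JJ yields J = J' + J^(m+1),
and powers of J eventually vanish. -/
theorem range_eq_top_of_sup_mulSpan (T : TriangularData k H J) (g : J' →ₙₐ[k] J)
    (hg : LinearMap.range (g : J' →ₗ[k] J) ⊔ mulSpan k J = ⊤) :
    LinearMap.range (g : J' →ₗ[k] J) = ⊤ := by
  -- `P m` is spanned by products of m + 1 factors, matching `nilpotent`; thus `P 0` is everything
  -- and `P n` is zero.
  let P : ℕ → Submodule k J := fun m => Submodule.span k
    {z | ∃ (x : J) (l : List J), l.length = m ∧ l.foldl (fun a b => a * b) x = z}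
  have hmulfold : ∀ (l : List J) (a x : J),
      a * l.foldl (fun a b => a * b) x = l.foldl (fun a b => a * b) (a * x) := by
    intro l
    induction l with
    | nil => intro a x; rfl
    | cons b l ih => intro a x; rw [List.foldl_cons, List.foldl_cons, ih, mul_assoc]
  have hleft : ∀ (m : ℕ) (a p : J), p ∈ P m → a * p ∈ P (m + 1) := by
    intro m a p hp
    have : P m ≤ (P (m + 1)).comap (LinearMap.mulLeft k a) := by
      rw [Submodule.span_le]
      rintro _ ⟨x, l, hl, rfl⟩
      refine Submodule.subset_span ⟨a, x :: l, by rw [List.length_cons, hl], ?_⟩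
      rw [List.foldl_cons, LinearMap.mulLeft_apply, hmulfold]
    exact this hp
  have hright : ∀ (m : ℕ) (a p : J), p ∈ P m → p * a ∈ P (m + 1) := by
    intro m a p hp
    have : P m ≤ (P (m + 1)).comap (LinearMap.mulRight k a) := by
      rw [Submodule.span_le]
      rintro _ ⟨x, l, hl, rfl⟩
      refine Submodule.subset_span ⟨x, l ++ [a], by simp [hl], ?_⟩
      rw [List.foldl_append]
      rfl
    exact this hp
  have key : ∀ m, LinearMap.range (g : J' →ₗ[k] J) ⊔ P m = ⊤ := by
    intro m
    induction m with
    | zero =>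
      refine eq_top_iff.2 fun x _ => Submodule.mem_sup_right (Submodule.subset_span ?_)
      exact ⟨x, [], rfl, rfl⟩
    | succ m ih =>
      rw [eq_top_iff, ← hg]
      refine sup_le le_sup_left ?_
      rw [mulSpan, Submodule.span_le]
      rintro _ ⟨x, y, rfl⟩
      obtain ⟨_, ⟨a, rfl⟩, p, hp, rfl⟩ := Submodule.mem_sup.1 (ih ▸ Submodule.mem_top (x := x))
      obtain ⟨_, ⟨b, rfl⟩, q, hq, rfl⟩ := Submodule.mem_sup.1 (ih ▸ Submodule.mem_top (x := y))
      rw [add_mul, mul_add, add_assoc]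
      refine add_mem (Submodule.mem_sup_left ⟨a * b, map_mul g a b⟩) (Submodule.mem_sup_right ?_)
      exact add_mem (hleft m _ _ hq) (hright m _ _ hp)
  obtain ⟨n, hn⟩ := T.nilpotent
  have h0 : P n = ⊥ := by
    rw [Submodule.span_eq_bot]
    rintro _ ⟨x, l, hl, rfl⟩
    exact hn x l hl
  have := key n
  rwa [h0, sup_bot_eq] at this

/-- `H + J'` for an `H`-invariant subalgebra `J'` of `J`. -/
def restrictData (T : TriangularData k H J) (S : NonUnitalSubalgebra k J)
    (hl : ∀ h, ∀ x ∈ S, T.left h x ∈ S) (hr : ∀ h, ∀ x ∈ S, T.right h x ∈ S) :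
    TriangularData k H S where
  left :=
    { toFun := fun h => (T.left h).restrict (p := S.toSubmodule) (q := S.toSubmodule) (hl h)
      map_one' := by ext x; simp
      map_mul' := fun a b => by ext x; simp }
  right :=
    { toFun := fun h => (T.right h).restrict (p := S.toSubmodule) (q := S.toSubmodule) (hr h)
      map_one' := by ext x; simp
      map_mul' := fun a b => by ext x; simp }
  left_right h h' x := Subtype.ext (T.left_right h h' x)
  left_mul h x y := Subtype.ext (T.left_mul h x y)
  right_mul h x y := Subtype.ext (T.right_mul h x y)
  mul_left h x y := Subtype.ext (T.mul_left h x y)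
  nilpotent := (SubData.toData (T := T) ⟨⊤, S, fun h _ => hl h, fun h _ => hr h⟩).nilpotent
  char_not_dvd := T.char_not_dvd

/-- The subalgebra `J' + JJ`. -/
def supMulSpan (g : J' →ₙₐ[k] J) : NonUnitalSubalgebra k J :=
  { LinearMap.range (g : J' →ₗ[k] J) ⊔ mulSpan k J with
    mul_mem' := fun {a b} _ _ => Submodule.mem_sup_right (mul_mem_mulSpan a b) }

theorem mem_supMulSpan {g : J' →ₙₐ[k] J} {x : J} :
    x ∈ supMulSpan g ↔ x ∈ LinearMap.range (g : J' →ₗ[k] J) ⊔ mulSpan k J := Iff.rfl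

theorem map_mem_supMulSpan {g : J' →ₙₐ[k] J} (f : Module.End k J)
    (hf : ∀ x, f (g x) ∈ LinearMap.range (g : J' →ₗ[k] J))
    (hf' : ∀ x y, ∃ x' y', f (x * y) = x' * y') {x : J} (hx : x ∈ supMulSpan g) :
    f x ∈ supMulSpan g := by
  rw [mem_supMulSpan] at hx ⊢
  obtain ⟨_, ⟨a, rfl⟩, p, hp, rfl⟩ := Submodule.mem_sup.1 hx
  rw [map_add]
  refine add_mem (Submodule.mem_sup_left (hf a)) (Submodule.mem_sup_right ?_)
  have : mulSpan k J ≤ (mulSpan k J).comap f := by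
    rw [mulSpan, Submodule.span_le]
    rintro _ ⟨x, y, rfl⟩
    obtain ⟨x', y', h⟩ := hf' x y
    exact Submodule.mem_comap.2 (h ▸ mul_mem_mulSpan x' y')
  exact this hp

/-- Restriction from `H + J` to `H + J'`. -/
theorem comp_grpMap_mem_span [Finite k] [Finite H] [Finite J'] (T' : TriangularData k H J')
    {ε : AddChar k ℂ} (hε : ε ≠ 1) (n : ℕ) : ∀ {J : Type u} [NonUnitalRing J] [Module k J]
    [IsScalarTower k J J] [SMulCommClass k J J] [Module.Finite k J] (T : TriangularData k H J)
    {g : J' →ₙₐ[k] J} (hl : ∀ h x, g (T'.left h x) = T.left h (g x))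
    (hr : ∀ h x, g (T'.right h x) = T.right h (g x)) {χ : T.Grp → ℂ},
    Module.finrank k J = n → χ ∈ Submodule.span ℕ (T.supercharacters ε) →
    χ ∘ grpMap T' T (MonoidHom.id H) g hl hr ∈ Submodule.span ℕ (T'.supercharacters ε) := by
  induction n using Nat.strong_induction_on with
  | _ n ih =>
  intro J _ _ _ _ _ T g hl hr χ hn hχ
  have : Finite J := Module.finite_of_finite k
  by_cases htop : LinearMap.range (g : J' →ₗ[k] J) = ⊤
  · exact comp_grpMap_mem_span_of_mul_mem T' T hl hr
      (fun x y => htop.ge (Submodule.mem_top (x := x * y))) hε hχ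
  -- J' + JJ contains all products of J, so the preceding case restricts to it. It is proper by the
  -- Nakayama argument, so the dimension drops; treating J' through a homomorphism g lets it stay
  -- fixed while J shrinks.
  · let S := supMulSpan g
    have hSl : ∀ h, ∀ x ∈ S, T.left h x ∈ S := fun h x hx =>
      map_mem_supMulSpan (T.left h) (fun a => ⟨T'.left h a, hl h a⟩)
        (fun a b => ⟨_, _, T.left_mul h a b⟩) hx
    have hSr : ∀ h, ∀ x ∈ S, T.right h x ∈ S := fun h x hx =>
      map_mem_supMulSpan (T.right h) (fun a => ⟨T'.right h a, hr h a⟩)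
        (fun a b => ⟨_, _, T.right_mul h a b⟩) hx
    let T₁ := T.restrictData S hSl hSr
    have hgS : ∀ x, g x ∈ S := fun x => Submodule.mem_sup_left ⟨x, rfl⟩
    let g₁ : J' →ₙₐ[k] S := NonUnitalAlgHom.codRestrict g S hgS
    let i : S →ₙₐ[k] J := NonUnitalSubalgebraClass.subtype S
    have : Module.Finite k S := inferInstanceAs (Module.Finite k S.toSubmodule)
    have : Finite S := Module.finite_of_finite k
    have hlt : Module.finrank k S < n := by
      rw [← hn]
      exact Submodule.finrank_lt (s := S.toSubmodule)
        fun h => htop (T.range_eq_top_of_sup_mulSpan g h)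
    have h1 := comp_grpMap_mem_span_of_mul_mem T₁ T (g := i) (fun _ _ => rfl) (fun _ _ => rfl)
      (fun x y => ⟨⟨x * y, Submodule.mem_sup_right (mul_mem_mulSpan x y)⟩, rfl⟩) hε hχ
    exact ih _ hlt T₁ (g := g₁) (fun h x => Subtype.ext (hl h x)) (fun h x => Subtype.ext (hr h x))
      rfl h1

/-- `H' + J` for a subgroup `H'` of `H`. -/
def restrictGroup [Finite H] (T : TriangularData k H J) (K : Subgroup H) :
    TriangularData k K J where
  left := T.left.comp K.subtype
  right := T.right.comp K.subtype
  left_right h h' x := T.left_right h h' x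
  left_mul h x y := T.left_mul h x y
  right_mul h x y := T.right_mul h x y
  mul_left h x y := T.mul_left h x y
  nilpotent := T.nilpotent
  char_not_dvd hd := T.char_not_dvd (hd.trans K.card_subgroup_dvd_card)

end Chain

end TriangularData

theorem mainTheorem1 {k H J : Type*} [Field k] [Finite k] [CommGroup H] [Finite H]
    [NonUnitalRing J] [Module k J] [IsScalarTower k J J] [SMulCommClass k J J] [Module.Finite k J]
    (T : TriangularData k H J) (S : T.SubData) (ε : AddChar k ℂ) (hε : ε ≠ 1)
    (χ : T.Grp → ℂ) (hχ : χ ∈ T.supercharacters ε) :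
    ∃ m : (S.toData.Grp → ℂ) →₀ ℕ,
      (m.support : Set (S.toData.Grp → ℂ)) ⊆ S.toData.supercharacters ε ∧
      χ ∘ S.incl = m.sum fun φ n => n • φ := by
  have : Finite J := Module.finite_of_finite k
  -- H is cut down first, since J' is only assumed invariant under H'.
  have h1 := TriangularData.comp_grpMap_id_mem_span (T.restrictGroup S.subH) T S.subH.subtype
    (fun _ _ => rfl) (fun _ _ => rfl) ε (Submodule.subset_span hχ)
  have h2 := TriangularData.comp_grpMap_mem_span S.toData hε _ (T.restrictGroup S.subH)
    (g := NonUnitalSubalgebraClass.subtype S.subJ) (fun _ _ => rfl) (fun _ _ => rfl) rfl h1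
  obtain ⟨m, hm, hsum⟩ := Submodule.mem_span_set.1 h2
  exact ⟨m, hm, hsum.symm⟩
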